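/- \textbf{Theorem (pointwise inversion of the two-sided quaternion linear canonical transform).} Let $A_i=\begin{pmatrix}a_i&b_i\\c_i&d_i\end{pmatrix}\in\mathbb{R}^{2\times2}$ with $\det A_i=1$ and $b_i>0$ ($i=1,2$), let $\mathbb{H}$ be the real quaternions with units $\mathbf i,\mathbf j,\mathbf k$, and for a real matrix $A=\begin{pmatrix}a&b\\c&d\end{pmatrix}$ with $b\neq0$ and $\mu\in\{\mathbf i,\mathbf j\}$ put $$K_A^{\mu}(s,u)=\frac{1}{\sqrt{2\pi b\,\mu}}\;e^{\mu\left(\frac{a}{2b}s^2-\frac1b us+\frac{d}{2b}u^2\right)},$$ with the principal square root in the complex plane $\mathbb{R}+\mathbb{R}\mu$. For $f\in L^1(\mathbb{R}^2,\mathbb{H})$ let $$\mathcal{L}_T^{\mathbf i,\mathbf j}(f)(u,v)=\int_{\mathbb{R}^2}K_{A_1}^{\mathbf i}(s,u)\,f(s,t)\,K_{A_2}^{\mathbf j}(t,v)\,ds\,dt .$$ A real function $h$ on a rectangle $[\alpha_1,\beta_1]\times[\alpha_2,\beta_2]$ is a \emph{BVF} if the sums $\sum_{i<m}\sum_{j<n}|h(s_{i+1},t_{j+1})-h(s_{i+1},t_j)-h(s_i,t_{j+1})+h(s_i,t_j)|$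 are bounded over all subdivisions $\alpha_1=s_0<\dots<s_m=\beta_1$, $\alpha_2=t_0<\dots<t_n=\beta_2$, and $h(\tilde s,\cdot)$, $h(\cdot,\tilde t)$ are of bounded variation for at least one $\tilde s\in[\alpha_1,\beta_1]$ and at least one $\tilde t\in[\alpha_2,\beta_2]$. A quaternion-valued function is a \emph{QBVF} if its four real components are BVFs. For $g:\mathbb{R}^2\to\mathbb{H}$ let $\tilde g(s,t)=g(x_0-s,y_0-t)+g(x_0+s,y_0+t)+g(x_0-s,y_0+t)+g(x_0+s,y_0-t)$. We say that $g$ belongs to $\mathbf{LC}$ in the cross-neighborhood $\{|s-x_0|\le\varepsilon_1\text{ or }|t-y_0|\le\varepsilon_2\}$ of $(x_0,y_0)$ if there are $a,b\in\mathbb{R}$ with $\int_{\mathbb{R}}|\tilde g(a,t)|\,dt<\infty$, $\int_{\mathbb{R}}|\tilde g(s,b)|\,ds<\infty$ and $$\int_{\varepsilon_2}^{\infty}\!\int_0^{\varepsilon_1}\left|\frac{\tilde g(s,t)-\tilde g(a,t)}{s}\right|ds\,dt<\infty,\qquad \int_{\varepsilon_1}^{\infty}\!\int_0^{\varepsilon_2}\left|\frac{\tilde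 g(s,t)-\tilde g(s,b)}{t}\right|dt\,ds<\infty .$$ Let $(x_0,y_0)\in\mathbb{R}^2$, $\varepsilon_1,\varepsilon_2>0$ and $f\in L^1(\mathbb{R}^2,\mathbb{H})$. Suppose that $f$ is a QBVF on $[x_0-\varepsilon_1,x_0+\varepsilon_1]\times[y_0-\varepsilon_2,y_0+\varepsilon_2]$ and that the function $e^{\mathbf i\frac{a_1}{2b_1}s^2}f(s,t)\,e^{\mathbf j\frac{a_2}{2b_2}t^2}$ belongs to $\mathbf{LC}$ in the cross-neighborhood of $(x_0,y_0)$ given by $\varepsilon_1,\varepsilon_2$. Then the four limits $f(x_0\pm0,y_0\pm0)=\lim_{h,k\to0^+}f(x_0\pm h,y_0\pm k)$ (all four choices of signs) exist, and $$\lim_{\substack{M\to\infty\\N\to\infty}}\int_{-N}^{N}\!\int_{-M}^{M}K_{A_1^{-1}}^{\mathbf i}(u,x_0)\,\mathcal{L}_T^{\mathbf i,\mathbf j}(f)(u,v)\,K_{A_2^{-1}}^{\mathbf j}(v,y_0)\,du\,dv$$ $$=\frac{f(x_0+0,y_0+0)+f(x_0+0,y_0-0)+f(x_0-0,y_0+0)+f(x_0-0,y_0-0)}{4},$$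 where $M$ and $N$ tend to infinity independently of each other. -/

import Mathlib

open MeasureTheory Filter Topology
open scoped Quaternion

namespace QLCT

/-- The quaternion unit `i`. -/
def qi : ℍ[ℝ] := ⟨0, 1, 0, 0⟩

/-- The quaternion unit `j`. -/
def qj : ℍ[ℝ] := ⟨0, 0, 1, 0⟩

/-- The copy of the complex number `x + y I` in the plane spanned by `1` and `μ`, that is
`x + y μ`.  For `μ = i` or `μ = j` this is an embedding of the field `ℂ` in the quaternions. -/
noncomputable def inPlane (μ : ℍ[ℝ]) (z : ℂ) : ℍ[ℝ] := (z.re : ℍ[ℝ]) + z.im • μ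

/-! ### Bounded variation in two variables (Hardy) -/

/-- `s 0 < s 1 < ⋯ < s m` is a subdivision of `[a, b]`. -/
def IsSubdivision (a b : ℝ) (m : ℕ) (s : ℕ → ℝ) : Prop :=
  s 0 = a ∧ s m = b ∧ ∀ i < m, s i < s (i + 1)

/-- The mixed second difference of `f` over the cell with lower left corner `(s, t)` and upper
right corner `(s', t')`. -/
def cellDiff (f : ℝ × ℝ → ℝ) (s s' t t' : ℝ) : ℝ :=
  f (s', t') - f (s', t) - f (s, t') + f (s, t)

/-- `f` is a function of bounded variation on the rectangle `[a₁, b₁] × [a₂, b₂]`. -/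
def IsBVF (f : ℝ × ℝ → ℝ) (a₁ b₁ a₂ b₂ : ℝ) : Prop :=
  (∃ C : ℝ, ∀ (m n : ℕ) (s t : ℕ → ℝ), IsSubdivision a₁ b₁ m s → IsSubdivision a₂ b₂ n t →
    ∑ i ∈ Finset.range m, ∑ j ∈ Finset.range n,
      |cellDiff f (s i) (s (i + 1)) (t j) (t (j + 1))| ≤ C) ∧
  (∃ s ∈ Set.Icc a₁ b₁, BoundedVariationOn (fun t => f (s, t)) (Set.Icc a₂ b₂)) ∧
  (∃ t ∈ Set.Icc a₂ b₂, BoundedVariationOn (fun s => f (s, t)) (Set.Icc a₁ b₁))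

/-- `f` is a quaternion bounded variation function on `[a₁, b₁] × [a₂, b₂]`: its four real
components are of bounded variation there. -/
def IsQBVF (f : ℝ × ℝ → ℍ[ℝ]) (a₁ b₁ a₂ b₂ : ℝ) : Prop :=
  IsBVF (fun p => (f p).re) a₁ b₁ a₂ b₂ ∧ IsBVF (fun p => (f p).imI) a₁ b₁ a₂ b₂ ∧
  IsBVF (fun p => (f p).imJ) a₁ b₁ a₂ b₂ ∧ IsBVF (fun p => (f p).imK) a₁ b₁ a₂ b₂

/-! ### The class LC -/

/-- The symmetrization of `g` about `(x₀, y₀)`. -/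
noncomputable def symmetrize (g : ℝ × ℝ → ℍ[ℝ]) (x₀ y₀ : ℝ) (s t : ℝ) : ℍ[ℝ] :=
  g (x₀ - s, y₀ - t) + g (x₀ + s, y₀ + t) + g (x₀ - s, y₀ + t) + g (x₀ + s, y₀ - t)

/-- `g` belongs to the class LC in the cross-neighborhood
`{|s - x₀| ≤ ε₁ or |t - y₀| ≤ ε₂}` of `(x₀, y₀)`. -/
def IsLC (g : ℝ × ℝ → ℍ[ℝ]) (x₀ y₀ ε₁ ε₂ : ℝ) : Prop :=
  (∃ a : ℝ, Integrable (fun t => symmetrize g x₀ y₀ a t) ∧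
    IntegrableOn (fun p : ℝ × ℝ => p.1⁻¹ • (symmetrize g x₀ y₀ p.1 p.2 - symmetrize g x₀ y₀ a p.2))
      (Set.Ioc 0 ε₁ ×ˢ Set.Ici ε₂)) ∧
  (∃ b : ℝ, Integrable (fun s => symmetrize g x₀ y₀ s b) ∧
    IntegrableOn (fun p : ℝ × ℝ => p.2⁻¹ • (symmetrize g x₀ y₀ p.1 p.2 - symmetrize g x₀ y₀ p.1 b))
      (Set.Ici ε₁ ×ˢ Set.Ioc 0 ε₂))

/-! ### The two-sided quaternion linear canonical transform -/

/-- The kernel `K_A^μ(s, u) = (2πbμ)^{-1/2} exp (μ (a s² / 2b - u s / b + d u² / 2b))` for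
`A = (a, b; c, d)` with `b ≠ 0`, computed in the plane spanned by `1` and `μ`, with the principal
square root. -/
noncomputable def kernel (μ : ℍ[ℝ]) (A : Matrix.SpecialLinearGroup (Fin 2) ℝ) (s u : ℝ) : ℍ[ℝ] :=
  inPlane μ
    (1 / (Complex.I * ((2 * Real.pi * A 0 1 : ℝ) : ℂ)) ^ (1 / 2 : ℂ) *
      Complex.exp (Complex.I *
        ((A 0 0 / (2 * A 0 1) * s ^ 2 - 1 / A 0 1 * (u * s) + A 1 1 / (2 * A 0 1) * u ^ 2 : ℝ)
          : ℂ)))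

/-- The two-sided quaternion linear canonical transform of `f` (for `b₁, b₂ ≠ 0`). -/
noncomputable def transform (A₁ A₂ : Matrix.SpecialLinearGroup (Fin 2) ℝ) (f : ℝ × ℝ → ℍ[ℝ])
    (u v : ℝ) : ℍ[ℝ] :=
  ∫ p : ℝ × ℝ, kernel qi A₁ p.1 u * f p * kernel qj A₂ p.2 v

/-- The inverse transform, truncated to `|u| ≤ M`, `|v| ≤ N`, of a function `F` of `(u, v)`. -/
noncomputable def truncatedInverse (A₁ A₂ : Matrix.SpecialLinearGroup (Fin 2) ℝ)
    (F : ℝ → ℝ → ℍ[ℝ]) (x₀ y₀ M N : ℝ) : ℍ[ℝ] :=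
  ∫ v in (-N)..N, ∫ u in (-M)..M, kernel qi A₁⁻¹ u x₀ * F u v * kernel qj A₂⁻¹ v y₀

/-- The chirp-modulated function `e^{i a₁ s² / 2b₁} f(s, t) e^{j a₂ t² / 2b₂}`. -/
noncomputable def chirped (A₁ A₂ : Matrix.SpecialLinearGroup (Fin 2) ℝ) (f : ℝ × ℝ → ℍ[ℝ])
    (p : ℝ × ℝ) : ℍ[ℝ] :=
  inPlane qi (Complex.exp (Complex.I * ((A₁ 0 0 / (2 * A₁ 0 1) * p.1 ^ 2 : ℝ) : ℂ))) * f p *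
    inPlane qj (Complex.exp (Complex.I * ((A₂ 0 0 / (2 * A₂ 0 1) * p.2 ^ 2 : ℝ) : ℂ)))

end QLCT

/-! Let `g` be the chirped function. Passing from `A` to `A⁻¹` swaps `a` with `d` and negates `b`,
so the quadratic terms in the frequency cancel in the product of the inverse and direct kernels.
Integrating this product over `|u| ≤ M` leaves `(1/π) sin (M (s - x₀) / b) / (s - x₀)` times the
quotient of the chirps at `s` and `x₀` (`integral_kernelC_inv_mul`). The `i`-kernels stay to the
left of `f` and the `j`-kernels to the right, each pair commutes inside its own plane, and the
Dirichlet kernels are real, hence central. Fubini therefore turns the truncated inverse into a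
double Dirichlet integral of `g` between two constant unchirping factors (`truncatedInverse_eq`).

The kernels are even, so the integral folds onto the first quadrant with `g` replaced by its
symmetrization (`integral_dirichletKer_smul_eq`). The lines `s = ε₁` and `t = ε₂` cut the quadrant
into four pieces. On the far corner `1 / (s t)` is bounded and the Riemann–Lebesgue lemma applies.
On a strip, condition LC makes the difference quotient integrable, so Riemann–Lebesgue applies to
it; the subtracted function depends on one variable only, and its integral is a convergent sine
integral times a one-variable Riemann–Lebesgue integral.

The box at the origin gives the limit. Abel summation bounds the integral of a function of
Hardy–Krause variation against a product kernel by the suprema of the primitives times the variation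
(`norm_integral_integral_smul_le`). Subtract the corner limit `L`. On a small box at the origin the
primitives are bounded uniformly in `M`, `N`, and the variation is small, since the half-open
intervals leave out the axes and any jumps there. On the rest one primitive decays like `1/M` or
`1/N` while the other stays bounded, so no relation between `M` and `N` is needed. The constant
contributes `(π/2)² L`, and `L` is the sum of the four chirped quadrant limits; with the factor
`1/π²`, unchirping leaves the average of the limits of `f`. These limits exist by the same smallness
of the variation near the corner. -/

namespace QLCT

/-! ### Variation of functions of one and two variables -/

section Variation

variable {E : Type*} [NormedAddCommGroup E]

/-- The variation of `h` along monotone sequences in `S` is at most `V`. -/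
def VariationLE (h : ℝ → E) (S : Set ℝ) (V : ℝ) : Prop :=
  ∀ (n : ℕ) (u : ℕ → ℝ), Monotone u → (∀ i, u i ∈ S) →
    ∑ i ∈ Finset.range n, ‖h (u (i + 1)) - h (u i)‖ ≤ V

/-- The mixed second difference of `F` over a cell. -/
def cellDelta (F : ℝ → ℝ → E) (s s' t t' : ℝ) : E :=
  F s' t' - F s' t - F s t' + F s t

/-- The Vitali variation of `F` along monotone sequences in `S` and `T` is at most `V`. -/
def CellVariationLE (F : ℝ → ℝ → E) (S T : Set ℝ) (V : ℝ) : Prop :=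
  ∀ (m n : ℕ) (u v : ℕ → ℝ), Monotone u → Monotone v → (∀ i, u i ∈ S) → (∀ j, v j ∈ T) →
    ∑ i ∈ Finset.range m, ∑ j ∈ Finset.range n,
      ‖cellDelta F (u i) (u (i + 1)) (v j) (v (j + 1))‖ ≤ V

/-- `F` is a function of Hardy–Krause variation on `S × T`, with all the relevant quantities
bounded by `V`. -/
structure HKBounded (F : ℝ → ℝ → E) (S T : Set ℝ) (V : ℝ) : Prop where
  cell : CellVariationLE F S T V
  fst : ∀ t ∈ T, VariationLE (fun s => F s t) S V
  snd : ∀ s ∈ S, VariationLE (F s) T V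
  norm : ∀ s ∈ S, ∀ t ∈ T, ‖F s t‖ ≤ V

theorem VariationLE.boundedVariationOn {h : ℝ → E} {S : Set ℝ} {V : ℝ} (hh : VariationLE h S V) :
    BoundedVariationOn h S := by
  refine ne_top_of_le_ne_top (b := ENNReal.ofReal V) ENNReal.ofReal_ne_top (iSup_le ?_)
  rintro ⟨n, u, hu, hus⟩
  simp only [edist_dist, dist_eq_norm]
  rw [← ENNReal.ofReal_sum_of_nonneg (fun _ _ => norm_nonneg _)]
  exact ENNReal.ofReal_le_ofReal (hh n u hu hus)

theorem variationLE_of_eVariationOn_le {h : ℝ → E} {S : Set ℝ} {V : ℝ} (hV : 0 ≤ V)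
    (hh : eVariationOn h S ≤ ENNReal.ofReal V) : VariationLE h S V := by
  intro n u hu hus
  have := (eVariationOn.sum_le (f := h) (n := n) hu hus).trans hh
  simp only [edist_dist, dist_eq_norm] at this
  rw [← ENNReal.ofReal_sum_of_nonneg (fun _ _ => norm_nonneg _)] at this
  exact (ENNReal.ofReal_le_ofReal_iff hV).1 this

theorem exists_variationLE {h : ℝ → E} {S : Set ℝ} (hh : BoundedVariationOn h S) :
    ∃ V, 0 ≤ V ∧ VariationLE h S V :=
  ⟨(eVariationOn h S).toReal, ENNReal.toReal_nonneg, variationLE_of_eVariationOn_le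
    ENNReal.toReal_nonneg (ENNReal.ofReal_toReal hh).ge⟩

theorem VariationLE.mono {h : ℝ → E} {S S' : Set ℝ} {V V' : ℝ} (hh : VariationLE h S V)
    (hS : S' ⊆ S) (hV : V ≤ V') : VariationLE h S' V' :=
  fun n u hu hus => (hh n u hu fun i => hS (hus i)).trans hV

theorem CellVariationLE.mono {F : ℝ → ℝ → E} {S S' T T' : Set ℝ} {V V' : ℝ}
    (hF : CellVariationLE F S T V) (hS : S' ⊆ S) (hT : T' ⊆ T) (hV : V ≤ V') :
    CellVariationLE F S' T' V' :=
  fun m n u v hu hv hus hvt =>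
    (hF m n u v hu hv (fun i => hS (hus i)) fun i => hT (hvt i)).trans hV

theorem HKBounded.mono {F : ℝ → ℝ → E} {S S' T T' : Set ℝ} {V V' : ℝ}
    (hF : HKBounded F S T V) (hS : S' ⊆ S) (hT : T' ⊆ T) (hV : V ≤ V') :
    HKBounded F S' T' V' :=
  ⟨hF.cell.mono hS hT hV, fun t ht => (hF.fst t (hT ht)).mono hS hV,
    fun s hs => (hF.snd s (hS hs)).mono hT hV,
    fun s hs t ht => (hF.norm s (hS hs) t (hT ht)).trans hV⟩

/-- The sequence `x, y, y, …`. -/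
def twoStep (x y : ℝ) (i : ℕ) : ℝ := if i = 0 then x else y

theorem twoStep_monotone {x y : ℝ} (h : x ≤ y) : Monotone (twoStep x y) := by
  intro i j hij
  unfold twoStep
  split_ifs with h1 h2 h2
  · rfl
  · exact h
  · omega
  · rfl

theorem twoStep_mem {x y : ℝ} {S : Set ℝ} (hx : x ∈ S) (hy : y ∈ S) (i : ℕ) :
    twoStep x y i ∈ S := by
  unfold twoStep
  split_ifs <;> assumption

theorem VariationLE.norm_sub_le {h : ℝ → E} {S : Set ℝ} {V : ℝ} (hh : VariationLE h S V)
    {x y : ℝ} (hx : x ∈ S) (hy : y ∈ S) : ‖h x - h y‖ ≤ V := by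
  rcases le_total x y with hxy | hxy
  · simpa [twoStep, norm_sub_rev] using
      hh 1 (twoStep x y) (twoStep_monotone hxy) (twoStep_mem hx hy)
  · simpa [twoStep] using hh 1 (twoStep y x) (twoStep_monotone hxy) (twoStep_mem hy hx)

theorem VariationLE.norm_le {h : ℝ → E} {a b V : ℝ} (hab : a < b)
    (hh : VariationLE h (Set.Ioc a b) V) {t : ℝ} (ht : t ∈ Set.Ioc a b) : ‖h t‖ ≤ ‖h b‖ + V := by
  have := hh.norm_sub_le ht ⟨hab, le_rfl⟩
  have h2 := norm_le_norm_add_norm_sub (h b) (h t)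
  rw [norm_sub_rev] at h2
  linarith

theorem cellDelta_swap (F : ℝ → ℝ → E) (s s' t t' : ℝ) :
    cellDelta (fun x y => F y x) s s' t t' = cellDelta F t t' s s' := by
  simp only [cellDelta]; abel

theorem CellVariationLE.swap {F : ℝ → ℝ → E} {S T : Set ℝ} {V : ℝ}
    (hF : CellVariationLE F S T V) : CellVariationLE (fun x y => F y x) T S V := by
  intro m n u v hu hv hus hvt
  rw [Finset.sum_comm]
  simp only [cellDelta_swap]
  exact hF n m v u hv hu hvt hus

theorem HKBounded.swap {F : ℝ → ℝ → E} {S T : Set ℝ} {V : ℝ} (hF : HKBounded F S T V) :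
    HKBounded (fun x y => F y x) T S V :=
  ⟨hF.cell.swap, hF.snd, hF.fst, fun s hs t ht => hF.norm t ht s hs⟩

/-- A single row of cells is a grid with one step in the second variable. Exchanging `t` and `t'`
only changes the sign of the mixed difference, so their order is irrelevant. -/
theorem CellVariationLE.sum_norm_cellDelta_le {F : ℝ → ℝ → E} {S T : Set ℝ} {V : ℝ}
    (hF : CellVariationLE F S T V) {t t' : ℝ} (ht : t ∈ T) (ht' : t' ∈ T) (n : ℕ) (u : ℕ → ℝ)
    (hu : Monotone u) (hus : ∀ i, u i ∈ S) :
    ∑ i ∈ Finset.range n, ‖cellDelta F (u i) (u (i + 1)) t t'‖ ≤ V := by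
  rcases le_total t t' with h | h
  · simpa [twoStep] using
      hF n 1 u (twoStep t t') hu (twoStep_monotone h) hus (twoStep_mem ht ht')
  · refine le_trans (le_of_eq ?_)
      (hF n 1 u (twoStep t' t) hu (twoStep_monotone h) hus (twoStep_mem ht' ht))
    refine Finset.sum_congr rfl fun i _ => ?_
    simp only [twoStep, Finset.range_one, Finset.sum_singleton, if_true, zero_add, one_ne_zero,
      if_false]
    rw [← norm_neg]
    simp only [cellDelta]; congr 1; abel

/-- An increment along the line at height `t` is the increment at height `t₀` plus a mixed
difference, which the Vitali variation controls. -/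
theorem CellVariationLE.variationLE_fst {F : ℝ → ℝ → E} {S T : Set ℝ} {V W : ℝ}
    (hF : CellVariationLE F S T W) {t₀ t : ℝ} (ht₀ : t₀ ∈ T) (ht : t ∈ T)
    (h : VariationLE (fun s => F s t₀) S V) : VariationLE (fun s => F s t) S (V + W) := by
  intro n u hu hus
  refine le_trans ?_ (add_le_add (h n u hu hus) (hF.sum_norm_cellDelta_le ht₀ ht n u hu hus))
  rw [← Finset.sum_add_distrib]
  refine Finset.sum_le_sum fun i _ => le_trans (le_of_eq ?_) (norm_add_le _ _)
  simp only [cellDelta]; congr 1; abel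

/-- Bounded Vitali variation, together with bounded variation on one line in each direction, gives
bounded variation on all lines. -/
theorem CellVariationLE.exists_hkBounded {F : ℝ → ℝ → E} {S T : Set ℝ} {V₁ V₂ W : ℝ}
    (hF : CellVariationLE F S T W) {s₀ t₀ : ℝ} (hs₀ : s₀ ∈ S) (ht₀ : t₀ ∈ T)
    (h₁ : VariationLE (fun s => F s t₀) S V₁) (h₂ : VariationLE (F s₀) T V₂) :
    ∃ V, HKBounded F S T V := by
  have hW : 0 ≤ W := by
    simpa using hF 0 0 (fun _ => s₀) (fun _ => t₀) monotone_const monotone_const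
      (fun _ => hs₀) (fun _ => ht₀)
  have h1 : 0 ≤ V₁ := by simpa using h₁ 0 (fun _ => s₀) monotone_const (fun _ => hs₀)
  have h2 : 0 ≤ V₂ := by simpa using h₂ 0 (fun _ => t₀) monotone_const (fun _ => ht₀)
  have h0 := norm_nonneg (F s₀ t₀)
  have e2 : ∀ s ∈ S, VariationLE (F s) T (V₂ + W) := fun s hs =>
    hF.swap.variationLE_fst (t₀ := s₀) hs₀ hs h₂
  refine ⟨V₁ + V₂ + W + ‖F s₀ t₀‖, hF.mono subset_rfl subset_rfl (by linarith), fun t ht =>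
    (hF.variationLE_fst ht₀ ht h₁).mono subset_rfl (by linarith), fun s hs =>
    (e2 s hs).mono subset_rfl (by linarith), fun s hs t ht => ?_⟩
  have a1 := (e2 s hs).norm_sub_le ht ht₀
  have a2 := h₁.norm_sub_le hs hs₀
  have : F s t = (F s t - F s t₀) + (F s t₀ - F s₀ t₀) + F s₀ t₀ := by abel
  rw [this]
  refine (norm_add₃_le).trans ?_
  linarith

theorem VariationLE.add {h₁ h₂ : ℝ → E} {S : Set ℝ} {V₁ V₂ : ℝ} (hh₁ : VariationLE h₁ S V₁)
    (hh₂ : VariationLE h₂ S V₂) : VariationLE (fun x => h₁ x + h₂ x) S (V₁ + V₂) := by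
  intro n u hu hus
  refine le_trans ?_ (add_le_add (hh₁ n u hu hus) (hh₂ n u hu hus))
  rw [← Finset.sum_add_distrib]
  refine Finset.sum_le_sum fun i _ => le_trans (le_of_eq ?_) (norm_add_le _ _)
  rw [add_sub_add_comm]

theorem CellVariationLE.add {F₁ F₂ : ℝ → ℝ → E} {S T : Set ℝ} {V₁ V₂ : ℝ}
    (h₁ : CellVariationLE F₁ S T V₁) (h₂ : CellVariationLE F₂ S T V₂) :
    CellVariationLE (fun s t => F₁ s t + F₂ s t) S T (V₁ + V₂) := by
  intro m n u v hu hv hus hvt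
  refine le_trans ?_ (add_le_add (h₁ m n u v hu hv hus hvt) (h₂ m n u v hu hv hus hvt))
  simp only [← Finset.sum_add_distrib]
  refine Finset.sum_le_sum fun i _ => Finset.sum_le_sum fun j _ =>
    le_trans (le_of_eq ?_) (norm_add_le _ _)
  simp only [cellDelta]; congr 1; abel

theorem HKBounded.add {F₁ F₂ : ℝ → ℝ → E} {S T : Set ℝ} {V₁ V₂ : ℝ}
    (h₁ : HKBounded F₁ S T V₁) (h₂ : HKBounded F₂ S T V₂) :
    HKBounded (fun s t => F₁ s t + F₂ s t) S T (V₁ + V₂) :=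
  ⟨h₁.cell.add h₂.cell, fun t ht => (h₁.fst t ht).add (h₂.fst t ht),
    fun s hs => (h₁.snd s hs).add (h₂.snd s hs),
    fun s hs t ht => (norm_add_le _ _).trans (add_le_add (h₁.norm s hs t ht) (h₂.norm s hs t ht))⟩

theorem HKBounded.sub_const {F : ℝ → ℝ → E} {S T : Set ℝ} {V : ℝ} (h : HKBounded F S T V)
    (c : E) : HKBounded (fun s t => F s t - c) S T (V + ‖c‖) := by
  have hc := norm_nonneg c
  refine ⟨fun m n u v hu hv hus hvt => ?_, fun t ht n u hu hus => ?_, fun s hs n u hu hus => ?_,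
    fun s hs t ht => (norm_sub_le _ _).trans (by gcongr; exact h.norm s hs t ht)⟩
  · refine le_trans (le_of_eq ?_) ((h.cell m n u v hu hv hus hvt).trans (by linarith))
    refine Finset.sum_congr rfl fun i _ => Finset.sum_congr rfl fun j _ => ?_
    simp only [cellDelta]; congr 1; abel
  · refine le_trans (le_of_eq ?_) ((h.fst t ht n u hu hus).trans (by linarith))
    simp
  · refine le_trans (le_of_eq ?_) ((h.snd s hs n u hu hus).trans (by linarith))
    simp

/-! ### Products with functions of one variable -/

section Bilinear

variable {A G : Type*} [NormedAddCommGroup A] [NormedAddCommGroup G] [NormedSpace ℝ E]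
  [NormedSpace ℝ A] [NormedSpace ℝ G]

/-- Functions of Hardy–Krause variation are stable under multiplication by functions of bounded
variation of the first variable. -/
theorem HKBounded.bilinear (B : A →L[ℝ] E →L[ℝ] G) {φ : ℝ → A} {F : ℝ → ℝ → E} {S T : Set ℝ}
    {C V : ℝ} (hC : 0 ≤ C) (hV : 0 ≤ V) (hφ : VariationLE φ S C) (hφ' : ∀ s ∈ S, ‖φ s‖ ≤ C)
    (hF : HKBounded F S T V) :
    HKBounded (fun s t => B (φ s) (F s t)) S T (‖B‖ * (2 * (C * V))) := by
  have hB := norm_nonneg B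
  have key : ∀ x y, ‖B x y‖ ≤ ‖B‖ * (‖x‖ * ‖y‖) := fun x y => by
    rw [← mul_assoc]; exact B.le_opNorm₂ x y
  have hCV : 0 ≤ C * V := mul_nonneg hC hV
  refine ⟨fun m n u v hu hv hus hvt => ?_, fun t ht n u hu hus => ?_, fun s hs n u hu hus => ?_,
    fun s hs t ht => (key _ _).trans ?_⟩
  · calc _ ≤ ∑ i ∈ Finset.range m, ∑ j ∈ Finset.range n,
          ‖B‖ * (C * ‖cellDelta F (u i) (u (i + 1)) (v j) (v (j + 1))‖ +
            ‖φ (u (i + 1)) - φ (u i)‖ * ‖F (u i) (v (j + 1)) - F (u i) (v j)‖) := by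
          refine Finset.sum_le_sum fun i _ => Finset.sum_le_sum fun j _ => ?_
          -- Discrete Leibniz rule: `φ` is frozen at the right end point in the first term, `F` at
          -- the left one in the second.
          have : cellDelta (fun s t => B (φ s) (F s t)) (u i) (u (i + 1)) (v j) (v (j + 1)) =
              B (φ (u (i + 1))) (cellDelta F (u i) (u (i + 1)) (v j) (v (j + 1))) +
              B (φ (u (i + 1)) - φ (u i)) (F (u i) (v (j + 1)) - F (u i) (v j)) := by
            simp only [cellDelta, map_add, map_sub, sub_apply]; abel
          rw [this, mul_add]
          refine (norm_add_le _ _).trans (add_le_add ((key _ _).trans ?_) (key _ _))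
          gcongr
          exact hφ' _ (hus _)
      _ = ‖B‖ * (C * (∑ i ∈ Finset.range m, ∑ j ∈ Finset.range n,
            ‖cellDelta F (u i) (u (i + 1)) (v j) (v (j + 1))‖) +
            ∑ i ∈ Finset.range m, ‖φ (u (i + 1)) - φ (u i)‖ *
              ∑ j ∈ Finset.range n, ‖F (u i) (v (j + 1)) - F (u i) (v j)‖) := by
          simp only [Finset.mul_sum, Finset.sum_add_distrib, mul_add]
      _ ≤ ‖B‖ * (C * V + ∑ i ∈ Finset.range m, ‖φ (u (i + 1)) - φ (u i)‖ * V) := by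
          gcongr with i _
          · exact hF.cell m n u v hu hv hus hvt
          · exact hF.snd _ (hus i) n v hv hvt
      _ ≤ ‖B‖ * (C * V + C * V) := by
          rw [← Finset.sum_mul]
          gcongr
          exact hφ m u hu hus
      _ = _ := by ring
  · calc _ ≤ ∑ i ∈ Finset.range n, ‖B‖ * (C * ‖F (u (i + 1)) t - F (u i) t‖ +
            ‖φ (u (i + 1)) - φ (u i)‖ * V) := by
          refine Finset.sum_le_sum fun i _ => ?_
          have : B (φ (u (i + 1))) (F (u (i + 1)) t) - B (φ (u i)) (F (u i) t) =
              B (φ (u (i + 1))) (F (u (i + 1)) t - F (u i) t) +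
              B (φ (u (i + 1)) - φ (u i)) (F (u i) t) := by
            simp only [map_sub, sub_apply]; abel
          rw [this, mul_add]
          refine (norm_add_le _ _).trans (add_le_add ((key _ _).trans ?_) ((key _ _).trans ?_))
          · gcongr
            exact hφ' _ (hus _)
          · gcongr
            exact hF.norm _ (hus _) _ ht
      _ = ‖B‖ * (C * (∑ i ∈ Finset.range n, ‖F (u (i + 1)) t - F (u i) t‖) +
            (∑ i ∈ Finset.range n, ‖φ (u (i + 1)) - φ (u i)‖) * V) := by
          simp only [Finset.mul_sum, Finset.sum_add_distrib, mul_add, Finset.sum_mul]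
      _ ≤ ‖B‖ * (C * V + C * V) := by
          gcongr
          · exact hF.fst t ht n u hu hus
          · exact hφ n u hu hus
      _ = _ := by ring
  · calc _ ≤ ∑ i ∈ Finset.range n, ‖B‖ * (C * ‖F s (u (i + 1)) - F s (u i)‖) := by
          refine Finset.sum_le_sum fun i _ => ?_
          simp only [← map_sub]
          refine (key _ _).trans ?_
          gcongr
          exact hφ' _ hs
      _ = ‖B‖ * (C * ∑ i ∈ Finset.range n, ‖F s (u (i + 1)) - F s (u i)‖) := by
          simp only [Finset.mul_sum]
      _ ≤ ‖B‖ * (2 * (C * V)) := by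
          have := hF.snd s hs n u hu hus
          have := mul_le_mul_of_nonneg_left this hC
          exact mul_le_mul_of_nonneg_left (by linarith) hB
  · have := mul_le_mul (hφ' s hs) (hF.norm s hs t ht) (norm_nonneg _) hC
    exact mul_le_mul_of_nonneg_left (by linarith) hB

end Bilinear

/-! ### Reparametrization -/

/-- Reverse the first `n + 1` terms. Truncated subtraction makes the new sequence constant from
index `n` on. Reversal exchanges the two end points of each step, hence the symmetry required of
`g`. -/
theorem exists_monotone_of_antitone {u : ℕ → ℝ} (hu : Antitone u) (n : ℕ) :
    ∃ w : ℕ → ℝ, Monotone w ∧ (∀ i, ∃ j, w i = u j) ∧ ∀ g : ℝ → ℝ → ℝ, (∀ x y, g x y = g y x) →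
      ∑ i ∈ Finset.range n, g (u i) (u (i + 1)) = ∑ i ∈ Finset.range n, g (w i) (w (i + 1)) := by
  refine ⟨fun i => u (n - i), fun i j hij => hu (by omega), fun i => ⟨_, rfl⟩, fun g hg => ?_⟩
  rw [← Finset.sum_range_reflect]
  refine Finset.sum_congr rfl fun i hi => ?_
  have : i < n := Finset.mem_range.1 hi
  rw [hg]
  congr 2 <;> omega

theorem HKBounded.comp_antitone {F : ℝ → ℝ → E} {S S' T : Set ℝ} {V : ℝ}
    (hF : HKBounded F S T V) {σ : ℝ → ℝ} (hσ : Antitone σ) (hS : Set.MapsTo σ S' S) :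
    HKBounded (fun s t => F (σ s) t) S' T V := by
  refine ⟨fun m n u v hu hv hus hvt => ?_, fun t ht n u hu hus => ?_,
    fun _ hs => hF.snd _ (hS hs), fun _ hs => hF.norm _ (hS hs)⟩
  · obtain ⟨w, hw, hwu, hsum⟩ := exists_monotone_of_antitone (hσ.comp_monotone hu) m
    have := hsum (fun x y => ∑ j ∈ Finset.range n, ‖cellDelta F x y (v j) (v (j + 1))‖)
      fun x y => Finset.sum_congr rfl fun j _ => by
        rw [← norm_neg]; simp only [cellDelta]; congr 1; abel
    refine le_trans (le_of_eq this) (hF.cell m n w v hw hv (fun i => ?_) hvt)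
    obtain ⟨j, hj⟩ := hwu i
    exact hj ▸ hS (hus j)
  · obtain ⟨w, hw, hwu, hsum⟩ := exists_monotone_of_antitone (hσ.comp_monotone hu) n
    have := hsum (fun x y => ‖F y t - F x t‖) fun x y => norm_sub_rev _ _
    refine le_trans (le_of_eq this) (hF.fst t ht n w hw fun i => ?_)
    obtain ⟨j, hj⟩ := hwu i
    exact hj ▸ hS (hus j)

theorem HKBounded.comp_monotone {F : ℝ → ℝ → E} {S S' T : Set ℝ} {V : ℝ}
    (hF : HKBounded F S T V) {σ : ℝ → ℝ} (hσ : Monotone σ) (hS : Set.MapsTo σ S' S) :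
    HKBounded (fun s t => F (σ s) t) S' T V :=
  ⟨fun m n u v hu hv hus hvt => hF.cell m n (σ ∘ u) v (hσ.comp hu) hv (fun i => hS (hus i)) hvt,
    fun t ht n u hu hus => hF.fst t ht n (σ ∘ u) (hσ.comp hu) fun i => hS (hus i),
    fun _ hs => hF.snd _ (hS hs), fun _ hs => hF.norm _ (hS hs)⟩

/-! ### Behaviour near the corner -/

/-- The point `0` is excluded, so a jump there is not counted and the variation on `(0, δ]` tends to
`0` with `δ`. -/
theorem eventually_variationLE_Ioc {h : ℝ → E} {b η : ℝ} (hb : 0 < b) (hη : 0 < η)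
    (hh : BoundedVariationOn h (Set.Ioc 0 b)) :
    ∀ᶠ δ in 𝓝[>] (0 : ℝ), VariationLE h (Set.Ioc 0 δ) η := by
  have h1 := hh.tendsto_eVariationOn_Ioc_zero 0
  rw [nhdsWithin_Ioc_eq_nhdsGT hb] at h1
  have h2 := (tendsto_order.1 h1).2 (ENNReal.ofReal η) (ENNReal.ofReal_pos.2 hη)
  filter_upwards [h2, Ioc_mem_nhdsGT hb] with δ hδ hδb
  refine variationLE_of_eVariationOn_le hη.le ?_
  rw [Set.inter_eq_right.2 (Set.Ioc_subset_Ioc_right hδb.2)] at hδ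
  exact hδ.le

/-- Run through `u'` up to index `m'`, then through `u`. The bridge from `u' m'` to `u 0` is a
nonnegative extra term, which is why only an inequality holds. -/
theorem exists_concat {u u' : ℕ → ℝ} (hu : Monotone u) (hu' : Monotone u')
    (h : ∀ i j, u' i ≤ u j) (m m' : ℕ) :
    ∃ (n : ℕ) (w : ℕ → ℝ), Monotone w ∧ (∀ i, (∃ j, w i = u j) ∨ ∃ j, w i = u' j) ∧
      ∀ g : ℝ → ℝ → ℝ, (∀ x y, 0 ≤ g x y) →
        ∑ i ∈ Finset.range m', g (u' i) (u' (i + 1)) + ∑ i ∈ Finset.range m, g (u i) (u (i + 1)) ≤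
          ∑ i ∈ Finset.range n, g (w i) (w (i + 1)) := by
  refine ⟨m' + 1 + m, fun i => if i ≤ m' then u' i else u (i - (m' + 1)), ?_, ?_, ?_⟩
  · intro i j hij
    dsimp only
    split_ifs with h1 h2 h2
    · exact hu' hij
    · exact h _ _
    · omega
    · exact hu (by omega)
  · intro i
    dsimp only
    split_ifs
    · exact Or.inr ⟨_, rfl⟩
    · exact Or.inl ⟨_, rfl⟩
  · intro g hg
    rw [Finset.sum_range_add, Finset.sum_range_succ]
    have e1 : ∀ i ∈ Finset.range m', g (u' i) (u' (i + 1)) =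
        g (if i ≤ m' then u' i else u (i - (m' + 1)))
          (if i + 1 ≤ m' then u' (i + 1) else u (i + 1 - (m' + 1))) := by
      intro i hi
      have : i < m' := Finset.mem_range.1 hi
      rw [if_pos (by omega), if_pos (by omega)]
    have e2 : ∀ i ∈ Finset.range m, g (u i) (u (i + 1)) =
        g (if m' + 1 + i ≤ m' then u' (m' + 1 + i) else u (m' + 1 + i - (m' + 1)))
          (if m' + 1 + i + 1 ≤ m' then u' (m' + 1 + i + 1) else u (m' + 1 + i + 1 - (m' + 1))) := by
      intro i hi
      rw [if_neg (by omega), if_neg (by omega)]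
      congr 2 <;> omega
    rw [Finset.sum_congr rfl e1, Finset.sum_congr rfl e2]
    have := hg (if m' ≤ m' then u' m' else u (m' - (m' + 1)))
      (if m' + 1 ≤ m' then u' (m' + 1) else u (m' + 1 - (m' + 1)))
    linarith

/-- Choose a grid whose sum is within `η` of the supremum of all grid sums. Any grid in the box
below and to the left of its first point can be joined to it, and the joined sum is still at most
the supremum; so the added grid contributes less than `η`. -/
theorem CellVariationLE.exists_small {F : ℝ → ℝ → E} {b d V η : ℝ} (hb : 0 < b) (hd : 0 < d)
    (hη : 0 < η) (hF : CellVariationLE F (Set.Ioc 0 b) (Set.Ioc 0 d) V) :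
    ∃ δ₁ ∈ Set.Ioc 0 b, ∃ δ₂ ∈ Set.Ioc 0 d,
      CellVariationLE F (Set.Ioc 0 δ₁) (Set.Ioc 0 δ₂) η := by
  let P : Set ℝ := {x | ∃ (m n : ℕ) (u v : ℕ → ℝ), Monotone u ∧ Monotone v ∧
    (∀ i, u i ∈ Set.Ioc 0 b) ∧ (∀ j, v j ∈ Set.Ioc 0 d) ∧
    x = ∑ i ∈ Finset.range m, ∑ j ∈ Finset.range n,
      ‖cellDelta F (u i) (u (i + 1)) (v j) (v (j + 1))‖}
  have hP : P.Nonempty := ⟨_, 0, 0, fun _ => b, fun _ => d, monotone_const, monotone_const,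
    fun _ => ⟨hb, le_rfl⟩, fun _ => ⟨hd, le_rfl⟩, rfl⟩
  have hP' : BddAbove P := ⟨V, by
    rintro _ ⟨m, n, u, v, hu, hv, hus, hvt, rfl⟩
    exact hF m n u v hu hv hus hvt⟩
  obtain ⟨_, ⟨m, n, u, v, hu, hv, hus, hvt, rfl⟩, hx⟩ :=
    exists_lt_of_lt_csSup hP (sub_lt_self (sSup P) hη)
  refine ⟨u 0, hus 0, v 0, hvt 0, fun m' n' u' v' hu' hv' hus' hvt' => ?_⟩
  obtain ⟨k, w, hw, hwu, hws⟩ :=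
    exists_concat hu hu' (fun i j => (hus' i).2.trans (hu (Nat.zero_le j))) m m'
  obtain ⟨l, z, hz, hzv, hzs⟩ :=
    exists_concat hv hv' (fun i j => (hvt' i).2.trans (hv (Nat.zero_le j))) n n'
  have hwm : ∀ i, w i ∈ Set.Ioc 0 b := by
    intro i
    rcases hwu i with ⟨j, hj⟩ | ⟨j, hj⟩
    · exact hj ▸ hus j
    · exact hj ▸ ⟨(hus' j).1, (hus' j).2.trans (hus 0).2⟩
  have hzm : ∀ i, z i ∈ Set.Ioc 0 d := by
    intro i
    rcases hzv i with ⟨j, hj⟩ | ⟨j, hj⟩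
    · exact hj ▸ hvt j
    · exact hj ▸ ⟨(hvt' j).1, (hvt' j).2.trans (hvt 0).2⟩
  have htop := le_csSup hP' ⟨k, l, w, z, hw, hz, hwm, hzm, rfl⟩
  have hz' := fun x y => hzs (fun p q => ‖cellDelta F x y p q‖) (fun _ _ => norm_nonneg _)
  have hw' := hws (fun x y => ∑ j ∈ Finset.range l, ‖cellDelta F x y (z j) (z (j + 1))‖)
    (fun _ _ => Finset.sum_nonneg fun _ _ => norm_nonneg _)
  have a1 : ∑ i ∈ Finset.range m', ∑ j ∈ Finset.range n',
      ‖cellDelta F (u' i) (u' (i + 1)) (v' j) (v' (j + 1))‖ ≤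
      ∑ i ∈ Finset.range m', ∑ j ∈ Finset.range l,
        ‖cellDelta F (u' i) (u' (i + 1)) (z j) (z (j + 1))‖ :=
    Finset.sum_le_sum fun i _ => le_trans (le_add_of_nonneg_right
      (Finset.sum_nonneg fun _ _ => norm_nonneg _)) (hz' _ _)
  have a2 : ∑ i ∈ Finset.range m, ∑ j ∈ Finset.range n,
      ‖cellDelta F (u i) (u (i + 1)) (v j) (v (j + 1))‖ ≤
      ∑ i ∈ Finset.range m, ∑ j ∈ Finset.range l,
        ‖cellDelta F (u i) (u (i + 1)) (z j) (z (j + 1))‖ :=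
    Finset.sum_le_sum fun i _ => le_trans (le_add_of_nonneg_left
      (Finset.sum_nonneg fun _ _ => norm_nonneg _)) (hz' _ _)
  linarith

end Variation

/-! ### Integrals of functions of bounded variation against oscillating kernels -/

section Riemann

/-- The points of the uniform subdivision of `[a, b]` into `n + 1` intervals. -/
noncomputable def grid (a b : ℝ) (n j : ℕ) : ℝ := a + (b - a) / (n + 1) * j

/-- The right end point of the interval of the uniform subdivision which contains `t`. -/
noncomputable def gridCeil (a b : ℝ) (n : ℕ) (t : ℝ) : ℝ :=
  a + (b - a) / (n + 1) * ⌈(t - a) / ((b - a) / (n + 1))⌉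

variable {a b : ℝ}

theorem grid_zero (n : ℕ) : grid a b n 0 = a := by simp [grid]

theorem grid_last (n : ℕ) : grid a b n (n + 1) = b := by
  have : (n : ℝ) + 1 ≠ 0 := by positivity
  simp only [grid]; push_cast; field_simp; ring

theorem grid_strictMono (hab : a < b) (n : ℕ) : StrictMono (grid a b n) := by
  intro i j hij
  have : 0 < (b - a) / (n + 1) := div_pos (sub_pos.2 hab) (by positivity)
  have h2 : (i : ℝ) < j := by exact_mod_cast hij
  simp only [grid]
  gcongr

theorem grid_mem_Icc (hab : a < b) {n j : ℕ} (hj : j ≤ n + 1) :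
    grid a b n j ∈ Set.Icc a b := by
  have h := (grid_strictMono hab n).monotone
  exact ⟨(grid_zero (a := a) (b := b) n).symm.le.trans (h (Nat.zero_le j)),
    (h hj).trans (grid_last n).le⟩

theorem grid_succ_mem_Ioc (hab : a < b) {n j : ℕ} (hj : j ≤ n) :
    grid a b n (j + 1) ∈ Set.Ioc a b := by
  have h := (grid_strictMono hab n)
  exact ⟨(grid_zero (a := a) (b := b) n).symm.le.trans_lt (h (Nat.succ_pos j)),
    (h.monotone (by omega : j + 1 ≤ n + 1)).trans (grid_last n).le⟩

theorem gridCeil_eq (hab : a < b) {n j : ℕ} {t : ℝ}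
    (ht : t ∈ Set.Ioc (grid a b n j) (grid a b n (j + 1))) :
    gridCeil a b n t = grid a b n (j + 1) := by
  have hw : 0 < (b - a) / (n + 1) := div_pos (sub_pos.2 hab) (by positivity)
  obtain ⟨h1, h2⟩ := ht
  simp only [grid] at h1 h2
  have : ⌈(t - a) / ((b - a) / (n + 1))⌉ = ((j + 1 : ℕ) : ℤ) := by
    rw [Int.ceil_eq_iff, lt_div_iff₀ hw, div_le_iff₀ hw]
    push_cast at h2 ⊢
    constructor <;> linarith
  rw [gridCeil, this, grid, Int.cast_natCast]

theorem gridCeil_bounds (hab : a < b) (n : ℕ) (t : ℝ) :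
    t ≤ gridCeil a b n t ∧ gridCeil a b n t ≤ t + (b - a) / (n + 1) := by
  have hw : 0 < (b - a) / (n + 1) := div_pos (sub_pos.2 hab) (by positivity)
  have h1 := Int.le_ceil ((t - a) / ((b - a) / (n + 1)))
  have h2 := Int.ceil_lt_add_one ((t - a) / ((b - a) / (n + 1)))
  have h1' := mul_le_mul_of_nonneg_left h1 hw.le
  have h2' := mul_le_mul_of_nonneg_left h2.le hw.le
  rw [mul_add, mul_div_cancel₀ _ hw.ne'] at h2'
  rw [mul_div_cancel₀ _ hw.ne'] at h1'
  rw [gridCeil]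
  constructor <;> linarith

theorem gridCeil_mem (hab : a < b) (n : ℕ) {t : ℝ} (ht : t ∈ Set.Ioc a b) :
    gridCeil a b n t ∈ Set.Ioc a b := by
  have hw : 0 < (b - a) / (n + 1) := div_pos (sub_pos.2 hab) (by positivity)
  refine ⟨ht.1.trans_le (gridCeil_bounds hab n t).1, ?_⟩
  have h1 : ⌈(t - a) / ((b - a) / (n + 1))⌉ ≤ ((n + 1 : ℕ) : ℤ) := by
    rw [Int.ceil_le, div_le_iff₀ hw]
    have : (n : ℝ) + 1 ≠ 0 := by positivity
    push_cast
    rw [mul_div_cancel₀ _ this]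
    linarith [ht.2]
  have h2 : ((⌈(t - a) / ((b - a) / (n + 1))⌉ : ℤ) : ℝ) ≤ ((n + 1 : ℕ) : ℝ) := by exact_mod_cast h1
  have h3 := mul_le_mul_of_nonneg_left h2 hw.le
  have h4 := grid_last (a := a) (b := b) n
  rw [grid] at h4
  rw [gridCeil]
  linarith

theorem tendsto_gridCeil (hab : a < b) (t : ℝ) :
    Tendsto (fun n => gridCeil a b n t) atTop (𝓝 t) := by
  have h : Tendsto (fun n : ℕ => t + (b - a) / ((n : ℝ) + 1)) atTop (𝓝 (t + 0)) :=
    tendsto_const_nhds.add (tendsto_const_nhds.div_atTop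
      (tendsto_natCast_atTop_atTop.atTop_add tendsto_const_nhds))
  rw [add_zero] at h
  exact tendsto_of_tendsto_of_tendsto_of_le_of_le tendsto_const_nhds h
    (fun n => (gridCeil_bounds hab n t).1) fun n => (gridCeil_bounds hab n t).2

variable {E : Type*} [NormedAddCommGroup E] [NormedSpace ℝ E]

theorem intervalIntegrable_smul_gridCeil (hab : a < b) (h : ℝ → E) {l : ℝ → ℝ} (hl : Continuous l)
    (n j : ℕ) :
    IntervalIntegrable (fun t => l t • h (gridCeil a b n t)) volume (grid a b n j)
      (grid a b n (j + 1)) := by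
  have hle := (grid_strictMono hab n).monotone (Nat.le_succ j)
  have h1 : IntervalIntegrable (fun t => l t • h (grid a b n (j + 1))) volume (grid a b n j)
      (grid a b n (j + 1)) := (hl.smul continuous_const).intervalIntegrable _ _
  refine h1.congr ?_
  intro t ht
  rw [Set.uIoc_of_le hle] at ht
  simp only [gridCeil_eq hab ht]

theorem integral_smul_gridCeil [CompleteSpace E] (hab : a < b) (h : ℝ → E) {l : ℝ → ℝ} (hl :
    Continuous l)
    (n : ℕ) :
    IntegrableOn (fun t => l t • h (gridCeil a b n t)) (Set.Ioc a b) ∧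
    ∫ t in Set.Ioc a b, l t • h (gridCeil a b n t) =
      ∑ j ∈ Finset.range (n + 1), (∫ t in (grid a b n j)..(grid a b n (j + 1)), l t) •
        h (grid a b n (j + 1)) := by
  have h1 : IntervalIntegrable (fun t => l t • h (gridCeil a b n t)) volume (grid a b n 0)
      (grid a b n (n + 1)) :=
    IntervalIntegrable.trans_iterate fun k _ => intervalIntegrable_smul_gridCeil hab h hl n k
  have h2 := intervalIntegral.sum_integral_adjacent_intervals (a := grid a b n) (n := n + 1)
    fun k _ => intervalIntegrable_smul_gridCeil hab h hl n k
  rw [grid_zero, grid_last] at h1 h2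
  refine ⟨(intervalIntegrable_iff_integrableOn_Ioc_of_le hab.le).1 h1, ?_⟩
  rw [← intervalIntegral.integral_of_le hab.le, ← h2]
  refine Finset.sum_congr rfl fun j _ => ?_
  have hle := (grid_strictMono hab n).monotone (Nat.le_succ j)
  rw [← intervalIntegral.integral_smul_const, intervalIntegral.integral_of_le hle,
    intervalIntegral.integral_of_le hle]
  exact setIntegral_congr_fun measurableSet_Ioc fun t ht => by simp only [gridCeil_eq hab ht]

variable [FiniteDimensional ℝ E]

/-- A function of bounded variation with values in a finite-dimensional space is differentiable,
hence continuous, almost everywhere, and the grid points approach `t` inside the interval. -/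
theorem VariationLE.ae_tendsto_gridCeil {h : ℝ → E} {V : ℝ} (hab : a < b)
    (hh : VariationLE h (Set.Ioc a b) V) :
    ∀ᵐ t ∂volume.restrict (Set.Ioc a b),
      Tendsto (fun n => h (gridCeil a b n t)) atTop (𝓝 (h t)) := by
  filter_upwards [hh.boundedVariationOn.locallyBoundedVariationOn.ae_differentiableWithinAt
    measurableSet_Ioc, ae_restrict_mem measurableSet_Ioc] with t ht htm
  exact ht.continuousWithinAt.tendsto.comp (tendsto_nhdsWithin_iff.2
    ⟨tendsto_gridCeil hab t, Eventually.of_forall fun n => gridCeil_mem hab n htm⟩)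

theorem VariationLE.integrableOn {h : ℝ → E} {V : ℝ} (hab : a < b)
    (hh : VariationLE h (Set.Ioc a b) V) : IntegrableOn h (Set.Ioc a b) := by
  have := FiniteDimensional.complete ℝ E
  have hm : AEStronglyMeasurable h (volume.restrict (Set.Ioc a b)) := by
    refine aestronglyMeasurable_of_tendsto_ae atTop (fun n => ?_) (hh.ae_tendsto_gridCeil hab)
    -- With weight `1` the step functions `h ∘ gridCeil` are measurable, and `h` is their almost
    -- everywhere limit.
    simpa using (integral_smul_gridCeil hab h (continuous_const (y := (1 : ℝ))) n).1.1
  refine Integrable.of_bound hm (‖h b‖ + V) ?_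
  filter_upwards [ae_restrict_mem measurableSet_Ioc] with t ht
  exact hh.norm_le hab ht

theorem VariationLE.integrableOn_smul {h : ℝ → E} {V : ℝ} (hab : a < b)
    (hh : VariationLE h (Set.Ioc a b) V) {l : ℝ → ℝ} (hl : Continuous l) :
    IntegrableOn (fun t => l t • h t) (Set.Ioc a b) := by
  have h1 : IntegrableOn l (Set.Ioc a b) :=
    (hl.integrableOn_Icc (a := a) (b := b)).mono_set Set.Ioc_subset_Icc_self
  refine Integrable.smul_bdd h1 (‖h b‖ + V) (hh.integrableOn hab).1 ?_
  filter_upwards [ae_restrict_mem measurableSet_Ioc] with t ht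
  exact hh.norm_le hab ht

/-- The weight is integrated exactly over each cell and only `h` is sampled. The sums are thus
increments of a primitive of `l` times values of `h`, the form in which Abel summation applies. -/
theorem VariationLE.tendsto_riemann {h : ℝ → E} {V : ℝ} (hab : a < b)
    (hh : VariationLE h (Set.Ioc a b) V) {l : ℝ → ℝ} (hl : Continuous l) :
    Tendsto (fun n : ℕ => ∑ j ∈ Finset.range (n + 1),
      (∫ t in (grid a b n j)..(grid a b n (j + 1)), l t) • h (grid a b n (j + 1))) atTop
      (𝓝 (∫ t in Set.Ioc a b, l t • h t)) := by
  have := FiniteDimensional.complete ℝ E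
  simp only [← (integral_smul_gridCeil hab h hl _).2]
  refine tendsto_integral_of_dominated_convergence (fun t => ‖l t‖ * (‖h b‖ + V))
    (fun n => (integral_smul_gridCeil hab h hl n).1.1) ?_ (fun n => ?_) ?_
  · exact (((hl.norm.mul continuous_const).integrableOn_Icc (a := a) (b := b))).mono_set
      Set.Ioc_subset_Icc_self
  · filter_upwards [ae_restrict_mem measurableSet_Ioc] with t ht
    rw [norm_smul]
    exact mul_le_mul_of_nonneg_left (hh.norm_le hab (gridCeil_mem hab n ht)) (norm_nonneg _)
  · filter_upwards [hh.ae_tendsto_gridCeil hab] with t ht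
    exact ht.const_smul _

end Riemann

/-! ### Abel summation and estimates by primitives -/

section Abel

variable {E : Type*} [NormedAddCommGroup E] [NormedSpace ℝ E]

theorem sum_sub_smul_eq (Λ : ℕ → ℝ) (h0 : Λ 0 = 0) (y : ℕ → E) (m : ℕ) :
    ∑ j ∈ Finset.range (m + 1), (Λ (j + 1) - Λ j) • y j =
      Λ (m + 1) • y m - ∑ j ∈ Finset.range m, Λ (j + 1) • (y (j + 1) - y j) := by
  induction m with
  | zero => simp [h0]
  | succ m ih =>
    rw [Finset.sum_range_succ, ih, Finset.sum_range_succ _ m]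
    simp only [sub_smul, smul_sub]
    abel

theorem norm_sum_sub_smul_le (Λ : ℕ → ℝ) (h0 : Λ 0 = 0) (y : ℕ → E) (m : ℕ) {K : ℝ}
    (hK : ∀ j ≤ m + 1, |Λ j| ≤ K) :
    ‖∑ j ∈ Finset.range (m + 1), (Λ (j + 1) - Λ j) • y j‖ ≤
      K * (‖y m‖ + ∑ j ∈ Finset.range m, ‖y (j + 1) - y j‖) := by
  rw [sum_sub_smul_eq Λ h0, mul_add, Finset.mul_sum]
  refine (norm_sub_le _ _).trans (add_le_add ?_ ((norm_sum_le _ _).trans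
    (Finset.sum_le_sum fun j hj => ?_)))
  · rw [norm_smul]
    exact mul_le_mul_of_nonneg_right (hK _ le_rfl) (norm_nonneg _)
  · rw [norm_smul]
    have : j < m := Finset.mem_range.1 hj
    exact mul_le_mul_of_nonneg_right (hK _ (by omega)) (norm_nonneg _)

variable [FiniteDimensional ℝ E] {a b : ℝ}

/-- A family of functions of jointly bounded variation, integrated against a kernel with small
primitive. -/
theorem sum_norm_integral_smul_le {ι : Type*} (s : Finset ι) {h : ι → ℝ → E} {V K : ℝ}
    (hab : a < b)
    (hh : ∀ i, ∃ C, VariationLE (h i) (Set.Ioc a b) C)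
    (hV : ∀ (n : ℕ) (v : ℕ → ℝ), Monotone v → (∀ j, v j ∈ Set.Ioc a b) →
      ∑ i ∈ s, ∑ j ∈ Finset.range n, ‖h i (v (j + 1)) - h i (v j)‖ ≤ V)
    {l : ℝ → ℝ} (hl : Continuous l) (hK : ∀ x ∈ Set.Icc a b, |∫ t in a..x, l t| ≤ K) :
    ∑ i ∈ s, ‖∫ t in Set.Ioc a b, l t • h i t‖ ≤ K * (∑ i ∈ s, ‖h i b‖ + V) := by
  have hK0 : 0 ≤ K := (abs_nonneg _).trans (hK a ⟨le_rfl, hab.le⟩)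
  refine le_of_tendsto (tendsto_finsetSum s fun i _ =>
    ((hh i).choose_spec.tendsto_riemann hab hl).norm) (Eventually.of_forall fun n => ?_)
  have hint : ∀ x y : ℝ, IntervalIntegrable l volume x y := fun x y => hl.intervalIntegrable x y
  have hΛ : ∀ j, ∫ t in (grid a b n j)..(grid a b n (j + 1)), l t =
      (∫ t in a..(grid a b n (j + 1)), l t) - ∫ t in a..(grid a b n j), l t := fun j =>
    (intervalIntegral.integral_interval_sub_left (hint _ _) (hint _ _)).symm
  calc _ ≤ ∑ i ∈ s, K * (‖h i b‖ + ∑ j ∈ Finset.range n,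
        ‖h i (grid a b n (j + 1 + 1)) - h i (grid a b n (j + 1))‖) := by
        refine Finset.sum_le_sum fun i _ => ?_
        simp only [hΛ]
        have := norm_sum_sub_smul_le (fun j => ∫ t in a..(grid a b n j), l t)
          (by simp [grid_zero]) (fun j => h i (grid a b n (j + 1))) n
          (K := K) (fun j hj => hK _ (grid_mem_Icc hab hj))
        simpa only [grid_last] using this
    _ = K * (∑ i ∈ s, ‖h i b‖ + ∑ i ∈ s, ∑ j ∈ Finset.range n,
        ‖h i (grid a b n (j + 1 + 1)) - h i (grid a b n (j + 1))‖) := by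
        rw [← Finset.sum_add_distrib, Finset.mul_sum]
    _ ≤ K * (∑ i ∈ s, ‖h i b‖ + V) := by
        gcongr
        -- The minimum keeps the sequence of right end points in `(a, b]` beyond index `n`, as `hV`
        -- asks for all indices.
        refine le_trans (le_of_eq ?_) (hV n (fun j => grid a b n (min j n + 1)) ?_ fun j =>
          grid_succ_mem_Ioc hab (min_le_right _ _))
        · refine Finset.sum_congr rfl fun i _ => Finset.sum_congr rfl fun j hj => ?_
          have : j < n := Finset.mem_range.1 hj
          rw [min_eq_left (by omega), min_eq_left (by omega)]
        · intro i j hij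
          exact (grid_strictMono hab n).monotone (by omega)

/-- This plays the role of the second mean value theorem: the oscillation of `l` enters only through
its primitive. -/
theorem VariationLE.norm_integral_smul_le {h : ℝ → E} {V K : ℝ} (hab : a < b)
    (hh : VariationLE h (Set.Ioc a b) V) {l : ℝ → ℝ} (hl : Continuous l)
    (hK : ∀ x ∈ Set.Icc a b, |∫ t in a..x, l t| ≤ K) :
    ‖∫ t in Set.Ioc a b, l t • h t‖ ≤ K * (‖h b‖ + V) := by
  simpa using sum_norm_integral_smul_le (Finset.univ : Finset Unit) (h := fun _ => h) hab
    (fun _ => ⟨V, hh⟩) (fun n v hv hvm => by simpa using hh n v hv hvm) hl hK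

/-- The two-dimensional estimate: the integral of a function of Hardy–Krause variation against a
product of kernels is controlled by the primitives of the kernels. -/
theorem norm_integral_integral_smul_le {F : ℝ → ℝ → E} {c d V V₁ V₂ W K L : ℝ}
    (hab : a < b) (hcd : c < d) (hF : HKBounded F (Set.Ioc a b) (Set.Ioc c d) V)
    (h₁ : VariationLE (fun s => F s d) (Set.Ioc a b) V₁)
    (h₂ : VariationLE (F b) (Set.Ioc c d) V₂)
    (hW : CellVariationLE F (Set.Ioc a b) (Set.Ioc c d) W)
    {k l : ℝ → ℝ} (hk : Continuous k) (hl : Continuous l)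
    (hK : ∀ x ∈ Set.Icc a b, |∫ t in a..x, k t| ≤ K)
    (hL : ∀ x ∈ Set.Icc c d, |∫ t in c..x, l t| ≤ L) :
    ‖∫ s in Set.Ioc a b, k s • ∫ t in Set.Ioc c d, l t • F s t‖ ≤
      K * L * (‖F b d‖ + V₁ + V₂ + W) := by
  have hK0 : 0 ≤ K := (abs_nonneg _).trans (hK a ⟨le_rfl, hab.le⟩)
  have hb : b ∈ Set.Ioc a b := ⟨hab, le_rfl⟩
  -- The inner integral has bounded variation in `s`: its increments integrate the differences of
  -- consecutive sections of `F`, whose joint variation is at most `W` and whose values at `d` add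
  -- up to at most `V₁`. The one-variable estimate then applies to the outer integral.
  have hg : VariationLE (fun s => ∫ t in Set.Ioc c d, l t • F s t) (Set.Ioc a b)
      (L * (V₁ + W)) := by
    intro n u hu hus
    have hL0 : 0 ≤ L := (abs_nonneg _).trans (hL c ⟨le_rfl, hcd.le⟩)
    have hsub : ∀ i, (∫ t in Set.Ioc c d, l t • F (u (i + 1)) t) -
        (∫ t in Set.Ioc c d, l t • F (u i) t) =
        ∫ t in Set.Ioc c d, l t • (F (u (i + 1)) t - F (u i) t) := fun i => by
      rw [← integral_sub ((hF.snd _ (hus _)).integrableOn_smul hcd hl)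
        ((hF.snd _ (hus _)).integrableOn_smul hcd hl)]
      simp only [smul_sub]
    simp only [hsub]
    refine (sum_norm_integral_smul_le (Finset.range n)
      (h := fun i t => F (u (i + 1)) t - F (u i) t) (V := W) hcd (fun i => ⟨V + V, ?_⟩) ?_ hl
      hL).trans ?_
    · intro m v hv hvm
      refine le_trans ?_ (add_le_add (hF.snd _ (hus (i + 1)) m v hv hvm)
        (hF.snd _ (hus i) m v hv hvm))
      rw [← Finset.sum_add_distrib]
      refine Finset.sum_le_sum fun j _ => le_trans (le_of_eq ?_) (norm_sub_le _ _)
      rw [sub_sub_sub_comm]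
    · intro m v hv hvm
      refine le_trans (le_of_eq ?_) (hW n m u v hu hv hus hvm)
      refine Finset.sum_congr rfl fun i _ => Finset.sum_congr rfl fun j _ => ?_
      simp only [cellDelta]; congr 1; abel
    · gcongr
      exact h₁ n u hu hus
  refine (hg.norm_integral_smul_le hab hk hK).trans ?_
  have h3 := h₂.norm_integral_smul_le hcd hl hL
  calc _ ≤ K * (L * (‖F b d‖ + V₂) + L * (V₁ + W)) := by gcongr
    _ = _ := by ring

end Abel

/-! ### The sine integral -/

section SineIntegral

/-- The sine integral. -/
noncomputable def sineIntegral (x : ℝ) : ℝ := ∫ t in (0 : ℝ)..x, Real.sinc t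

theorem hasDerivAt_exp_mul_sin (y x : ℝ) :
    HasDerivAt (fun x => -(Real.exp (-y * x) * (Real.cos x + y * Real.sin x)) / (1 + y ^ 2))
      (Real.exp (-y * x) * Real.sin x) x := by
  have h1 : HasDerivAt (fun x : ℝ => Real.exp (-y * x)) (Real.exp (-y * x) * (-y)) x := by
    simpa using ((hasDerivAt_id x).const_mul (-y)).exp
  have h2 : HasDerivAt (fun x : ℝ => Real.cos x + y * Real.sin x)
      (-Real.sin x + y * Real.cos x) x :=
    (Real.hasDerivAt_cos x).add ((Real.hasDerivAt_sin x).const_mul y)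
  convert! ((h1.mul h2).neg).div_const (1 + y ^ 2) using 1
  have : 1 + y ^ 2 ≠ 0 := by positivity
  field_simp
  ring

theorem integral_exp_mul_sin (y T : ℝ) :
    ∫ x in (0 : ℝ)..T, Real.exp (-y * x) * Real.sin x =
      (1 + y ^ 2)⁻¹ - Real.exp (-y * T) * (Real.cos T + y * Real.sin T) / (1 + y ^ 2) := by
  rw [intervalIntegral.integral_eq_sub_of_hasDerivAt (fun x _ => hasDerivAt_exp_mul_sin y x)
    ((by fun_prop : Continuous fun x => Real.exp (-y * x) * Real.sin x).intervalIntegrable _ _)]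
  simp
  ring

theorem integral_Ioi_exp_neg_mul {x : ℝ} (hx : 0 < x) :
    IntegrableOn (fun y : ℝ => Real.exp (-y * x)) (Set.Ioi 0) ∧
      ∫ y in Set.Ioi (0 : ℝ), Real.exp (-y * x) = x⁻¹ := by
  have h : (fun y : ℝ => Real.exp (-y * x)) = fun y => Real.exp (-x * y) := by
    ext y; ring_nf
  rw [h]
  refine ⟨integrableOn_exp_mul_Ioi (neg_lt_zero.2 hx) 0, ?_⟩
  rw [integral_exp_mul_Ioi (neg_lt_zero.2 hx)]
  simp [neg_div_neg_eq]

/-- Integrating the absolute value over `y` gives `|sinc x|`, which is integrable on the bounded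
interval. -/
theorem integrable_exp_mul_sin {T : ℝ} :
    Integrable (fun p : ℝ × ℝ => Real.exp (-p.2 * p.1) * Real.sin p.1)
      ((volume.restrict (Set.Ioc 0 T)).prod (volume.restrict (Set.Ioi (0 : ℝ)))) := by
  have hc : Continuous fun p : ℝ × ℝ => Real.exp (-p.2 * p.1) * Real.sin p.1 := by fun_prop
  rw [integrable_prod_iff hc.aestronglyMeasurable]
  constructor
  · filter_upwards [ae_restrict_mem measurableSet_Ioc] with x hx
    exact (integral_Ioi_exp_neg_mul hx.1).1.mul_const _
  · have : IntegrableOn (fun x : ℝ => |Real.sinc x|) (Set.Ioc 0 T) :=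
      (Real.continuous_sinc.abs.integrableOn_Icc (a := 0) (b := T)).mono_set
        Set.Ioc_subset_Icc_self
    refine this.congr_fun (fun x hx => ?_) measurableSet_Ioc
    simp only [norm_mul, Real.norm_eq_abs, Real.abs_exp]
    rw [integral_mul_const, (integral_Ioi_exp_neg_mul hx.1).2, Real.sinc_of_ne_zero hx.1.ne',
      abs_div, abs_of_pos hx.1]
    ring

/-- Write `1/x` as the integral of `exp (-y x)` over `y > 0` and integrate in `x` first. The main
term `1 / (1 + y²)` integrates to `π/2`; the remainder is at most `2 exp (-y T)` because `1 + y ≤ 2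
(1 + y²)`, and this integrates to `2/T`. -/
theorem abs_sineIntegral_sub_le {T : ℝ} (hT : 0 < T) :
    |sineIntegral T - Real.pi / 2| ≤ 2 / T := by
  have h1 : sineIntegral T = ∫ y in Set.Ioi (0 : ℝ), ∫ x in (0 : ℝ)..T,
      Real.exp (-y * x) * Real.sin x := by
    simp only [intervalIntegral.integral_of_le hT.le, sineIntegral]
    rw [← integral_integral_swap (f := fun x y => Real.exp (-y * x) * Real.sin x)
      integrable_exp_mul_sin]
    refine setIntegral_congr_fun measurableSet_Ioc fun x hx => ?_
    rw [integral_mul_const, (integral_Ioi_exp_neg_mul hx.1).2, Real.sinc_of_ne_zero hx.1.ne']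
    ring
  have hbd : ∀ y ∈ Set.Ioi (0 : ℝ),
      ‖Real.exp (-y * T) * (Real.cos T + y * Real.sin T) / (1 + y ^ 2)‖ ≤
        2 * Real.exp (-y * T) := by
    intro y hy
    have hy0 : 0 < y := hy
    have hp : (0 : ℝ) < 1 + y ^ 2 := by positivity
    rw [norm_div, norm_mul, Real.norm_eq_abs, Real.norm_eq_abs, Real.norm_eq_abs, Real.abs_exp,
      abs_of_pos hp, div_le_iff₀ hp]
    have h3 : |Real.cos T + y * Real.sin T| ≤ 1 + y := by
      refine (abs_add_le _ _).trans (add_le_add (Real.abs_cos_le_one T) ?_)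
      rw [abs_mul, abs_of_pos hy0]
      exact mul_le_of_le_one_right hy0.le (Real.abs_sin_le_one T)
    have h4 : 1 + y ≤ 2 * (1 + y ^ 2) := by nlinarith [sq_nonneg (y - 1)]
    nlinarith [Real.exp_pos (-y * T), mul_le_mul_of_nonneg_left (h3.trans h4)
      (Real.exp_pos (-y * T)).le]
  have hint : IntegrableOn (fun y : ℝ =>
      Real.exp (-y * T) * (Real.cos T + y * Real.sin T) / (1 + y ^ 2)) (Set.Ioi 0) := by
    refine Integrable.mono' ((integral_Ioi_exp_neg_mul hT).1.const_mul 2) ?_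
      ((ae_restrict_mem measurableSet_Ioi).mono hbd)
    have : Continuous (fun y : ℝ =>
        Real.exp (-y * T) * (Real.cos T + y * Real.sin T) / (1 + y ^ 2)) :=
      Continuous.div (by fun_prop) (by fun_prop) fun y => by positivity
    exact this.aestronglyMeasurable
  simp only [integral_exp_mul_sin] at h1
  rw [integral_sub integrable_inv_one_add_sq.integrableOn hint, integral_Ioi_inv_one_add_sq,
    Real.arctan_zero, sub_zero] at h1
  rw [h1, sub_sub_cancel_left, abs_neg]
  refine (norm_integral_le_of_norm_le ((integral_Ioi_exp_neg_mul hT).1.const_mul 2)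
    ((ae_restrict_mem measurableSet_Ioi).mono hbd)).trans (le_of_eq ?_)
  rw [integral_const_mul, (integral_Ioi_exp_neg_mul hT).2]
  ring

theorem abs_sineIntegral_le {T : ℝ} (hT : 0 ≤ T) : |sineIntegral T| ≤ 4 := by
  rcases le_total T 1 with h | h
  · have := intervalIntegral.norm_integral_le_of_norm_le_const (a := 0) (b := T) (C := 1)
      (f := Real.sinc) fun x _ => by simpa using Real.abs_sinc_le_one x
    rw [sub_zero, abs_of_nonneg hT, Real.norm_eq_abs] at this
    rw [sineIntegral]
    linarith
  · have h1 := abs_sineIntegral_sub_le (zero_lt_one.trans_le h)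
    have h2 : 2 / T ≤ 2 := (div_le_iff₀ (by positivity)).2 (by linarith)
    have h3 := abs_le.1 (h1.trans h2)
    rw [abs_le]
    constructor <;> linarith [Real.pi_pos, Real.pi_le_four]

/-- The Dirichlet kernel `sin (M x) / x` of the real line. -/
noncomputable def dirichletKer (M x : ℝ) : ℝ := M * Real.sinc (M * x)

theorem continuous_dirichletKer (M : ℝ) : Continuous (dirichletKer M) :=
  continuous_const.mul (Real.continuous_sinc.comp (continuous_const.mul continuous_id))

theorem dirichletKer_of_ne_zero (M : ℝ) {x : ℝ} (hx : x ≠ 0) :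
    dirichletKer M x = Real.sin (M * x) * x⁻¹ := by
  rcases eq_or_ne M 0 with rfl | hM
  · simp [dirichletKer]
  · rw [dirichletKer, Real.sinc_of_ne_zero (mul_ne_zero hM hx)]
    field_simp

theorem dirichletKer_neg (M x : ℝ) : dirichletKer M (-x) = dirichletKer M x := by
  rw [dirichletKer, dirichletKer, mul_neg, Real.sinc_neg]

theorem abs_dirichletKer_le (M x : ℝ) : |dirichletKer M x| ≤ |M| := by
  rw [dirichletKer, abs_mul]
  exact mul_le_of_le_one_right (abs_nonneg _) (Real.abs_sinc_le_one _)

theorem integral_dirichletKer (M a b : ℝ) :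
    ∫ x in a..b, dirichletKer M x = sineIntegral (M * b) - sineIntegral (M * a) := by
  have hint : ∀ x y : ℝ, IntervalIntegrable Real.sinc volume x y :=
    fun x y => Real.continuous_sinc.intervalIntegrable x y
  simp only [dirichletKer]
  rw [intervalIntegral.integral_const_mul, intervalIntegral.mul_integral_comp_mul_left,
    sineIntegral, sineIntegral, intervalIntegral.integral_interval_sub_left (hint _ _) (hint _ _)]

/-- Uniform in `M`, for intervals that may touch the origin; away from it the next bound decays in
`M`. -/
theorem abs_integral_dirichletKer_le {M a b : ℝ} (hM : 0 ≤ M) (ha : 0 ≤ a) (hb : 0 ≤ b) :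
    |∫ x in a..b, dirichletKer M x| ≤ 8 := by
  rw [integral_dirichletKer]
  refine (abs_sub _ _).trans ?_
  linarith [abs_sineIntegral_le (mul_nonneg hM ha), abs_sineIntegral_le (mul_nonneg hM hb)]

theorem abs_integral_dirichletKer_le_div {M a b : ℝ} (hM : 0 < M) (ha : 0 < a) (hab : a ≤ b) :
    |∫ x in a..b, dirichletKer M x| ≤ 4 / (M * a) := by
  rw [integral_dirichletKer]
  have h1 := abs_sineIntegral_sub_le (mul_pos hM ha)
  have h2 := abs_sineIntegral_sub_le (mul_pos hM (ha.trans_le hab))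
  have h3 : 2 / (M * b) ≤ 2 / (M * a) := by gcongr
  have h4 : sineIntegral (M * b) - sineIntegral (M * a) =
    (sineIntegral (M * b) - Real.pi / 2) - (sineIntegral (M * a) - Real.pi / 2) := by ring
  rw [h4]
  refine (abs_sub _ _).trans ?_
  have h5 : 4 / (M * a) = 2 / (M * a) + 2 / (M * a) := by ring
  linarith

theorem tendsto_integral_dirichletKer {b : ℝ} (hb : 0 < b) :
    Tendsto (fun M => ∫ x in (0 : ℝ)..b, dirichletKer M x) atTop (𝓝 (Real.pi / 2)) := by
  rw [tendsto_iff_norm_sub_tendsto_zero]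
  have h : Tendsto (fun M : ℝ => 2 / (M * b)) atTop (𝓝 0) :=
    tendsto_const_nhds.div_atTop (tendsto_id.atTop_mul_const hb)
  refine squeeze_zero' (Eventually.of_forall fun _ => norm_nonneg _) ?_ h
  filter_upwards [eventually_gt_atTop 0] with M hM
  rw [integral_dirichletKer, mul_zero]
  simpa [sineIntegral] using abs_sineIntegral_sub_le (mul_pos hM hb)

end SineIntegral

/-! ### The double Dirichlet integral over a rectangle with a corner at the origin -/

section Corner

variable {E : Type*} [NormedAddCommGroup E]

/-- Near the corner, a function of Hardy–Krause variation has small variation. -/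
theorem HKBounded.exists_small {G : ℝ → ℝ → E} {b d V η : ℝ} (hb : 0 < b) (hd : 0 < d)
    (hη : 0 < η) (hG : HKBounded G (Set.Ioc 0 b) (Set.Ioc 0 d) V) :
    ∃ β₁ ∈ Set.Ioo 0 b, ∃ β₂ ∈ Set.Ioo 0 d,
      CellVariationLE G (Set.Ioc 0 β₁) (Set.Ioc 0 β₂) η ∧
      VariationLE (fun s => G s β₂) (Set.Ioc 0 β₁) (η + η) ∧
      VariationLE (G β₁) (Set.Ioc 0 β₂) (η + η) := by
  obtain ⟨δ₁, hδ₁, δ₂, hδ₂, hcell⟩ := hG.cell.exists_small hb hd hη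
  -- Smallness is obtained on the lines through `δ₁` and `δ₂`; moving to the lines through `β₁` and
  -- `β₂` costs one more `η` of cell variation, whence `η + η`.
  have e1 := eventually_variationLE_Ioc hb hη (hG.fst δ₂ hδ₂).boundedVariationOn
  have e2 := eventually_variationLE_Ioc hd hη (hG.snd δ₁ hδ₁).boundedVariationOn
  obtain ⟨β₁, h₁, hβ₁⟩ := (e1.and (Ioo_mem_nhdsGT hδ₁.1)).exists
  obtain ⟨β₂, h₂, hβ₂⟩ := (e2.and (Ioo_mem_nhdsGT hδ₂.1)).exists
  have i₁ : Set.Ioc 0 β₁ ⊆ Set.Ioc 0 δ₁ := Set.Ioc_subset_Ioc_right hβ₁.2.le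
  have i₂ : Set.Ioc 0 β₂ ⊆ Set.Ioc 0 δ₂ := Set.Ioc_subset_Ioc_right hβ₂.2.le
  refine ⟨β₁, ⟨hβ₁.1, hβ₁.2.trans_le hδ₁.2⟩, β₂, ⟨hβ₂.1, hβ₂.2.trans_le hδ₂.2⟩,
    hcell.mono i₁ i₂ le_rfl, ?_, ?_⟩
  · exact (hcell.mono i₁ subset_rfl le_rfl).variationLE_fst (t₀ := δ₂) ⟨hδ₂.1, le_rfl⟩
      ⟨hβ₂.1, hβ₂.2.le⟩ h₁
  · exact (hcell.mono subset_rfl i₂ le_rfl).swap.variationLE_fst (t₀ := δ₁) ⟨hδ₁.1, le_rfl⟩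
      ⟨hβ₁.1, hβ₁.2.le⟩ h₂

/-- Move horizontally at height `t`, which costs `2η + η`, then vertically along `β₁`, which costs
`2η`. -/
theorem norm_sub_corner_le {G : ℝ → ℝ → E} {β₁ β₂ η : ℝ}
    (hc : CellVariationLE G (Set.Ioc 0 β₁) (Set.Ioc 0 β₂) η)
    (h₁ : VariationLE (fun s => G s β₂) (Set.Ioc 0 β₁) (η + η))
    (h₂ : VariationLE (G β₁) (Set.Ioc 0 β₂) (η + η)) {s t : ℝ} (hs : s ∈ Set.Ioc 0 β₁)
    (ht : t ∈ Set.Ioc 0 β₂) : ‖G s t - G β₁ β₂‖ ≤ 5 * η := by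
  have hs' : β₁ ∈ Set.Ioc 0 β₁ := ⟨hs.1.trans_le hs.2, le_rfl⟩
  have ht' : β₂ ∈ Set.Ioc 0 β₂ := ⟨ht.1.trans_le ht.2, le_rfl⟩
  have a1 := (hc.variationLE_fst ht' ht h₁).norm_sub_le hs hs'
  have a2 := h₂.norm_sub_le ht ht'
  refine (norm_sub_le_norm_sub_add_norm_sub _ (G β₁ t) _).trans ?_
  linarith

theorem eventually_mem_Ioc_prod {β₁ β₂ : ℝ} (h₁ : 0 < β₁) (h₂ : 0 < β₂) :
    ∀ᶠ p : ℝ × ℝ in 𝓝[>] 0 ×ˢ 𝓝[>] 0, p.1 ∈ Set.Ioc 0 β₁ ∧ p.2 ∈ Set.Ioc 0 β₂ :=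
  Filter.Eventually.prod_mk (Ioc_mem_nhdsGT h₁) (Ioc_mem_nhdsGT h₂)

/-- A function of Hardy–Krause variation has a limit at the corner. -/
theorem HKBounded.exists_tendsto [CompleteSpace E] {G : ℝ → ℝ → E} {b d V : ℝ} (hb : 0 < b)
    (hd : 0 < d) (hG : HKBounded G (Set.Ioc 0 b) (Set.Ioc 0 d) V) :
    ∃ L, Tendsto (fun p : ℝ × ℝ => G p.1 p.2) (𝓝[>] 0 ×ˢ 𝓝[>] 0) (𝓝 L) := by
  rw [← cauchy_map_iff_exists_tendsto, Metric.cauchy_iff]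
  refine ⟨inferInstance, fun ε hε => ?_⟩
  obtain ⟨β₁, hβ₁, β₂, hβ₂, hc, h₁, h₂⟩ := hG.exists_small hb hd (η := ε / 20) (by positivity)
  refine ⟨_, image_mem_map (eventually_mem_Ioc_prod hβ₁.1 hβ₂.1), ?_⟩
  rintro _ ⟨p, hp, rfl⟩ _ ⟨q, hq, rfl⟩
  have a1 := norm_sub_corner_le hc h₁ h₂ hp.1 hp.2
  have a2 := norm_sub_corner_le hc h₁ h₂ hq.1 hq.2
  have a3 := dist_triangle_right (G p.1 p.2) (G q.1 q.2) (G β₁ β₂)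
  rw [dist_eq_norm (G p.1 p.2) (G β₁ β₂), dist_eq_norm (G q.1 q.2)] at a3
  linarith

theorem norm_corner_sub_le {G : ℝ → ℝ → E} {β₁ β₂ η : ℝ} (hβ₁ : 0 < β₁) (hβ₂ : 0 < β₂)
    (hc : CellVariationLE G (Set.Ioc 0 β₁) (Set.Ioc 0 β₂) η)
    (h₁ : VariationLE (fun s => G s β₂) (Set.Ioc 0 β₁) (η + η))
    (h₂ : VariationLE (G β₁) (Set.Ioc 0 β₂) (η + η)) {L : E}
    (hL : Tendsto (fun p : ℝ × ℝ => G p.1 p.2) (𝓝[>] 0 ×ˢ 𝓝[>] 0) (𝓝 L)) :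
    ‖G β₁ β₂ - L‖ ≤ 5 * η := by
  rw [norm_sub_rev]
  refine le_of_tendsto (hL.sub_const _).norm ?_
  filter_upwards [eventually_mem_Ioc_prod hβ₁ hβ₂] with p hp
  exact norm_sub_corner_le hc h₁ h₂ hp.1 hp.2

variable [NormedSpace ℝ E]

theorem continuous_dirichletKer_prod (M N : ℝ) :
    Continuous fun p : ℝ × ℝ => dirichletKer M p.1 * dirichletKer N p.2 :=
  ((continuous_dirichletKer M).comp continuous_fst).mul
    ((continuous_dirichletKer N).comp continuous_snd)

theorem integrable_dirichletKer_smul {μ : Measure (ℝ × ℝ)} {H : ℝ × ℝ → E} (hH : Integrable H μ)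
    (M N : ℝ) : Integrable (fun p => (dirichletKer M p.1 * dirichletKer N p.2) • H p) μ := by
  refine hH.bdd_smul (|M| * |N|) (continuous_dirichletKer_prod M N).aestronglyMeasurable ?_
  filter_upwards with p
  rw [norm_mul]
  exact mul_le_mul (abs_dirichletKer_le _ _) (abs_dirichletKer_le _ _) (abs_nonneg _)
    (abs_nonneg _)

theorem setIntegral_Ioc_prod_add {H : ℝ × ℝ → E} {a b c : ℝ} {T : Set ℝ} (hab : a ≤ b)
    (hbc : b ≤ c) (hT : MeasurableSet T) (hH : IntegrableOn H (Set.Ioc a c ×ˢ T)) :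
    ∫ p in Set.Ioc a c ×ˢ T, H p =
      (∫ p in Set.Ioc a b ×ˢ T, H p) + ∫ p in Set.Ioc b c ×ˢ T, H p := by
  rw [← Set.Ioc_union_Ioc_eq_Ioc hab hbc, Set.union_prod] at hH ⊢
  exact setIntegral_union (Set.disjoint_prod.2 (Or.inl (Set.Ioc_disjoint_Ioc_of_le le_rfl)))
    (measurableSet_Ioc.prod hT) hH.left_of_union hH.right_of_union

theorem setIntegral_prod_Ioc_add {H : ℝ × ℝ → E} {a b c : ℝ} {S : Set ℝ} (hab : a ≤ b)
    (hbc : b ≤ c) (hS : MeasurableSet S) (hH : IntegrableOn H (S ×ˢ Set.Ioc a c)) :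
    ∫ p in S ×ˢ Set.Ioc a c, H p =
      (∫ p in S ×ˢ Set.Ioc a b, H p) + ∫ p in S ×ˢ Set.Ioc b c, H p := by
  rw [← Set.Ioc_union_Ioc_eq_Ioc hab hbc, Set.prod_union] at hH ⊢
  exact setIntegral_union (Set.disjoint_prod.2 (Or.inr (Set.Ioc_disjoint_Ioc_of_le le_rfl)))
    (hS.prod measurableSet_Ioc) hH.left_of_union hH.right_of_union

variable [FiniteDimensional ℝ E]

theorem norm_setIntegral_dirichletKer_le {F : ℝ → ℝ → E} {a b c d V V₁ V₂ W K L M N : ℝ}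
    (hab : a < b) (hcd : c < d) (hF : HKBounded F (Set.Ioc a b) (Set.Ioc c d) V)
    (hI : IntegrableOn (fun p : ℝ × ℝ => F p.1 p.2) (Set.Ioc a b ×ˢ Set.Ioc c d))
    (h₁ : VariationLE (fun s => F s d) (Set.Ioc a b) V₁)
    (h₂ : VariationLE (F b) (Set.Ioc c d) V₂)
    (hW : CellVariationLE F (Set.Ioc a b) (Set.Ioc c d) W)
    (hK : ∀ x ∈ Set.Icc a b, |∫ t in a..x, dirichletKer M t| ≤ K)
    (hL : ∀ x ∈ Set.Icc c d, |∫ t in c..x, dirichletKer N t| ≤ L) :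
    ‖∫ p in Set.Ioc a b ×ˢ Set.Ioc c d, (dirichletKer M p.1 * dirichletKer N p.2) • F p.1 p.2‖ ≤
      K * L * (‖F b d‖ + V₁ + V₂ + W) := by
  rw [Measure.volume_eq_prod, setIntegral_prod _ (integrable_dirichletKer_smul hI M N)]
  simp only [mul_smul, integral_smul]
  exact norm_integral_integral_smul_le hab hcd hF h₁ h₂ hW (continuous_dirichletKer M)
    (continuous_dirichletKer N) hK hL

theorem norm_setIntegral_dirichletKer_le' {F : ℝ → ℝ → E} {a b c d V K L M N : ℝ}
    (hab : a < b) (hcd : c < d) (hF : HKBounded F (Set.Ioc a b) (Set.Ioc c d) V)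
    (hI : IntegrableOn (fun p : ℝ × ℝ => F p.1 p.2) (Set.Ioc a b ×ˢ Set.Ioc c d))
    (hK : ∀ x ∈ Set.Icc a b, |∫ t in a..x, dirichletKer M t| ≤ K)
    (hL : ∀ x ∈ Set.Icc c d, |∫ t in c..x, dirichletKer N t| ≤ L) :
    ‖∫ p in Set.Ioc a b ×ˢ Set.Ioc c d, (dirichletKer M p.1 * dirichletKer N p.2) • F p.1 p.2‖ ≤
      K * L * (4 * V) := by
  have hb : b ∈ Set.Ioc a b := ⟨hab, le_rfl⟩
  have hd : d ∈ Set.Ioc c d := ⟨hcd, le_rfl⟩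
  have hK0 : 0 ≤ K := (abs_nonneg _).trans (hK a ⟨le_rfl, hab.le⟩)
  have hL0 : 0 ≤ L := (abs_nonneg _).trans (hL c ⟨le_rfl, hcd.le⟩)
  refine (norm_setIntegral_dirichletKer_le hab hcd hF hI (hF.fst d hd) (hF.snd b hb) hF.cell hK
    hL).trans (mul_le_mul_of_nonneg_left ?_ (mul_nonneg hK0 hL0))
  linarith [hF.norm b hb d hd]

/-- The double Dirichlet integral of a function of Hardy–Krause variation whose limit at the corner
is zero. -/
theorem HKBounded.tendsto_setIntegral_of_tendsto_zero {G : ℝ → ℝ → E} {b d V : ℝ} (hb : 0 < b)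
    (hd : 0 < d) (hG : HKBounded G (Set.Ioc 0 b) (Set.Ioc 0 d) V)
    (hI : IntegrableOn (fun p : ℝ × ℝ => G p.1 p.2) (Set.Ioc 0 b ×ˢ Set.Ioc 0 d))
    (hL : Tendsto (fun p : ℝ × ℝ => G p.1 p.2) (𝓝[>] 0 ×ˢ 𝓝[>] 0) (𝓝 0)) :
    Tendsto (fun R : ℝ × ℝ => ∫ p in Set.Ioc 0 b ×ˢ Set.Ioc 0 d,
      (dirichletKer R.1 p.1 * dirichletKer R.2 p.2) • G p.1 p.2) (atTop ×ˢ atTop) (𝓝 0) := by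
  rw [Metric.tendsto_nhds]
  intro ε hε
  -- On the small box the bound is `8 · 8 · (5 + 2 + 2 + 1) η = 640 η`, which equals `ε / 2` for
  -- this `η`.
  obtain ⟨β₁, hβ₁, β₂, hβ₂, hc, h₁, h₂⟩ := hG.exists_small hb hd (η := ε / 1280) (by positivity)
  have h0 : ‖G β₁ β₂‖ ≤ 5 * (ε / 1280) := by
    simpa using norm_corner_sub_le hβ₁.1 hβ₂.1 hc h₁ h₂ hL
  -- The three terms bound the small box, the part above it, and the part to its right.
  have hlim : Tendsto (fun R : ℝ × ℝ => ε / 2 + 8 * (4 / (R.2 * β₂)) * (4 * V) +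
      4 / (R.1 * β₁) * 8 * (4 * V)) (atTop ×ˢ atTop) (𝓝 (ε / 2 + 8 * 0 * (4 * V) +
      0 * 8 * (4 * V))) := by
    refine (tendsto_const_nhds.add (Tendsto.mul_const _ (Tendsto.const_mul _ ?_))).add
      (Tendsto.mul_const _ (Tendsto.mul_const _ ?_))
    · exact tendsto_const_nhds.div_atTop (tendsto_snd.atTop_mul_const hβ₂.1)
    · exact tendsto_const_nhds.div_atTop (tendsto_fst.atTop_mul_const hβ₁.1)
  have hlt : ε / 2 + 8 * 0 * (4 * V) + 0 * 8 * (4 * V) < ε := by linarith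
  filter_upwards [hlim.eventually_lt_const hlt, (eventually_gt_atTop (0 : ℝ)).prod_mk
    (eventually_gt_atTop (0 : ℝ))] with R hR hpos
  obtain ⟨hM, hN⟩ := hpos
  rw [dist_zero_right]
  refine lt_of_le_of_lt ?_ hR
  have i₁ : Set.Ioc 0 β₁ ⊆ Set.Ioc 0 b := Set.Ioc_subset_Ioc_right hβ₁.2.le
  have i₁' : Set.Ioc β₁ b ⊆ Set.Ioc 0 b := Set.Ioc_subset_Ioc_left hβ₁.1.le
  have i₂ : Set.Ioc 0 β₂ ⊆ Set.Ioc 0 d := Set.Ioc_subset_Ioc_right hβ₂.2.le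
  have i₂' : Set.Ioc β₂ d ⊆ Set.Ioc 0 d := Set.Ioc_subset_Ioc_left hβ₂.1.le
  have hint : IntegrableOn (fun p : ℝ × ℝ =>
      (dirichletKer R.1 p.1 * dirichletKer R.2 p.2) • G p.1 p.2) (Set.Ioc 0 b ×ˢ Set.Ioc 0 d) :=
    integrable_dirichletKer_smul hI _ _
  rw [setIntegral_Ioc_prod_add hβ₁.1.le hβ₁.2.le measurableSet_Ioc hint,
    setIntegral_prod_Ioc_add hβ₂.1.le hβ₂.2.le measurableSet_Ioc
      (hint.mono_set (Set.prod_mono i₁ subset_rfl))]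
  refine norm_add₃_le.trans (add_le_add (add_le_add ?_ ?_) ?_)
  · refine (norm_setIntegral_dirichletKer_le hβ₁.1 hβ₂.1 (hG.mono i₁ i₂ le_rfl)
      (hI.mono_set (Set.prod_mono i₁ i₂)) h₁ h₂ hc (K := 8) (L := 8) (fun x hx => ?_)
      fun x hx => ?_).trans ?_
    · exact abs_integral_dirichletKer_le hM.le le_rfl hx.1
    · exact abs_integral_dirichletKer_le hN.le le_rfl hx.1
    · linarith
  · refine norm_setIntegral_dirichletKer_le' hβ₁.1 hβ₂.2 (hG.mono i₁ i₂' le_rfl)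
      (hI.mono_set (Set.prod_mono i₁ i₂')) (fun x hx => ?_) fun x hx => ?_
    · exact abs_integral_dirichletKer_le hM.le le_rfl hx.1
    · exact abs_integral_dirichletKer_le_div hN hβ₂.1 hx.1
  · refine norm_setIntegral_dirichletKer_le' hβ₁.2 hd (hG.mono i₁' subset_rfl le_rfl)
      (hI.mono_set (Set.prod_mono i₁' subset_rfl)) (fun x hx => ?_) fun x hx => ?_
    · exact abs_integral_dirichletKer_le_div hM hβ₁.1 hx.1
    · exact abs_integral_dirichletKer_le hN.le le_rfl hx.1

/-- The double Dirichlet integral of a function of Hardy–Krause variation. -/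
theorem HKBounded.tendsto_setIntegral {G : ℝ → ℝ → E} {b d V : ℝ} (hb : 0 < b)
    (hd : 0 < d) (hG : HKBounded G (Set.Ioc 0 b) (Set.Ioc 0 d) V)
    (hI : IntegrableOn (fun p : ℝ × ℝ => G p.1 p.2) (Set.Ioc 0 b ×ˢ Set.Ioc 0 d)) {L : E}
    (hL : Tendsto (fun p : ℝ × ℝ => G p.1 p.2) (𝓝[>] 0 ×ˢ 𝓝[>] 0) (𝓝 L)) :
    Tendsto (fun R : ℝ × ℝ => ∫ p in Set.Ioc 0 b ×ˢ Set.Ioc 0 d,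
      (dirichletKer R.1 p.1 * dirichletKer R.2 p.2) • G p.1 p.2) (atTop ×ˢ atTop)
      (𝓝 ((Real.pi / 2 * (Real.pi / 2)) • L)) := by
  have := FiniteDimensional.complete ℝ E
  have hconst : IntegrableOn (fun _ : ℝ × ℝ => L) (Set.Ioc 0 b ×ˢ Set.Ioc 0 d) := by
    refine integrableOn_const ?_
    rw [Measure.volume_eq_prod, Measure.prod_prod]
    simp [ENNReal.mul_eq_top]
  have hsub : IntegrableOn (fun p : ℝ × ℝ => G p.1 p.2 - L) (Set.Ioc 0 b ×ˢ Set.Ioc 0 d) :=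
    hI.sub hconst
  -- Splitting off the corner limit leaves a function vanishing at the corner; the constant part is
  -- a product of two sine integrals, each tending to `π/2`.
  have h1 := (hG.sub_const L).tendsto_setIntegral_of_tendsto_zero hb hd hsub
    (by simpa using hL.sub_const L)
  have h2 : Tendsto (fun R : ℝ × ℝ => ((∫ x in (0 : ℝ)..b, dirichletKer R.1 x) *
      ∫ x in (0 : ℝ)..d, dirichletKer R.2 x) • L) (atTop ×ˢ atTop)
      (𝓝 ((Real.pi / 2 * (Real.pi / 2)) • L)) :=
    (((tendsto_integral_dirichletKer hb).comp tendsto_fst).mul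
      ((tendsto_integral_dirichletKer hd).comp tendsto_snd)).smul_const L
  have h3 := h1.add h2
  rw [zero_add] at h3
  refine h3.congr fun R => ?_
  have h4 : ((∫ x in (0 : ℝ)..b, dirichletKer R.1 x) * ∫ x in (0 : ℝ)..d, dirichletKer R.2 x) • L =
      ∫ p in Set.Ioc 0 b ×ˢ Set.Ioc 0 d, (dirichletKer R.1 p.1 * dirichletKer R.2 p.2) • L := by
    rw [integral_smul_const, Measure.volume_eq_prod,
      setIntegral_prod_mul (dirichletKer R.1) (dirichletKer R.2),
      intervalIntegral.integral_of_le hb.le, intervalIntegral.integral_of_le hd.le]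
  rw [h4, ← integral_add (integrable_dirichletKer_smul hsub _ _)
    (integrable_dirichletKer_smul hconst _ _)]
  simp only [← smul_add, sub_add_cancel]

end Corner

/-! ### The Riemann–Lebesgue lemma for products of sines -/

section RiemannLebesgue

/-- The frequency functional `(s, t) ↦ x s + y t` on the plane. -/
noncomputable def planeDual (x y : ℝ) : StrongDual ℝ (ℝ × ℝ) :=
  x • ContinuousLinearMap.fst ℝ ℝ ℝ + y • ContinuousLinearMap.snd ℝ ℝ ℝ

theorem planeDual_apply (x y : ℝ) (p : ℝ × ℝ) : planeDual x y p = x * p.1 + y * p.2 := by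
  simp [planeDual]

/-- Evaluation at `(1, 0)` bounds the norm below by `|x|`, so the second frequency may be arbitrary.
This lets `M` and `N` grow independently. -/
theorem tendsto_planeDual_cocompact {α : Type*} {l : Filter α} {x y : α → ℝ}
    (hx : Tendsto (fun a => |x a|) l atTop) :
    Tendsto (fun a => planeDual (x a) (y a)) l (cocompact (StrongDual ℝ (ℝ × ℝ))) := by
  rw [← Metric.cobounded_eq_cocompact, ← tendsto_norm_atTop_iff_cobounded]
  refine tendsto_atTop_mono (fun a => ?_) hx
  have := (planeDual (x a) (y a)).le_opNorm (1, 0)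
  simpa [planeDual_apply] using this

theorem sin_mul_sin_eq (α β : ℝ) : ((Real.sin α * Real.sin β : ℝ) : ℂ) =
    (Complex.exp (-(α - β) * Complex.I) + Complex.exp ((α - β) * Complex.I) -
      Complex.exp (-(α + β) * Complex.I) - Complex.exp ((α + β) * Complex.I)) / 4 := by
  push_cast
  rw [Complex.sin, Complex.sin]
  have e1 : Complex.exp (-(α - β) * Complex.I) =
      Complex.exp (-α * Complex.I) * Complex.exp (β * Complex.I) := by
    rw [← Complex.exp_add]; ring_nf
  have e2 : Complex.exp ((α - β) * Complex.I) =
      Complex.exp (α * Complex.I) * Complex.exp (-β * Complex.I) := by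
    rw [← Complex.exp_add]; ring_nf
  have e3 : Complex.exp (-(α + β) * Complex.I) =
      Complex.exp (-α * Complex.I) * Complex.exp (-β * Complex.I) := by
    rw [← Complex.exp_add]; ring_nf
  have e4 : Complex.exp ((α + β) * Complex.I) =
      Complex.exp (α * Complex.I) * Complex.exp (β * Complex.I) := by
    rw [← Complex.exp_add]; ring_nf
  rw [e1, e2, e3, e4]
  ring_nf
  rw [Complex.I_sq]
  ring

theorem integrable_cexp_mul {X : Type*} [MeasurableSpace X] [TopologicalSpace X]
    [OpensMeasurableSpace X] {μ : Measure X} {h : X → ℂ} (hh : Integrable h μ) {θ : X → ℝ}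
    (hθ : Continuous θ) : Integrable (fun p => Complex.exp (θ p * Complex.I) * h p) μ := by
  refine hh.bdd_mul (c := 1) ?_ ?_
  · exact (by fun_prop : Continuous fun p => Complex.exp (θ p * Complex.I)).aestronglyMeasurable
  · filter_upwards with p
    rw [Complex.norm_exp_ofReal_mul_I]

theorem tendsto_integral_cexp_plane {α : Type*} {l : Filter α} {x y : α → ℝ}
    (hx : Tendsto (fun a => |x a|) l atTop) (h : ℝ × ℝ → ℂ) :
    Tendsto (fun a => ∫ p : ℝ × ℝ, Complex.exp (((x a * p.1 + y a * p.2 : ℝ) : ℂ) * Complex.I) *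
      h p) l (𝓝 0) := by
  -- The factor `-1 / (2π)` converts to the Fourier character `exp (-2πi ·)`.
  have hx' : Tendsto (fun a => |-(x a) / (2 * Real.pi)|) l atTop := by
    simp only [abs_div, abs_neg]
    exact hx.atTop_div_const (abs_pos.2 (by positivity))
  have := (tendsto_integral_exp_smul_cocompact h (volume : Measure (ℝ × ℝ))).comp
    (tendsto_planeDual_cocompact (y := fun a => -(y a) / (2 * Real.pi)) hx')
  refine this.congr fun a => ?_
  simp only [Function.comp_apply]
  refine integral_congr_ae (Eventually.of_forall fun p => ?_)
  simp only [Circle.smul_def, Real.fourierChar_apply, planeDual_apply, smul_eq_mul]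
  congr 2
  have : (Real.pi : ℂ) ≠ 0 := by exact_mod_cast Real.pi_ne_zero
  push_cast
  field_simp
  ring

theorem integral_add_sub_sub_div {X : Type*} [MeasurableSpace X] {μ : Measure X}
    {f₁ f₂ f₃ f₄ : X → ℂ} (h₁ : Integrable f₁ μ) (h₂ : Integrable f₂ μ) (h₃ : Integrable f₃ μ)
    (h₄ : Integrable f₄ μ) (c : ℂ) :
    (∫ x, f₁ x ∂μ + ∫ x, f₂ x ∂μ - ∫ x, f₃ x ∂μ - ∫ x, f₄ x ∂μ) / c =
      ∫ x, (f₁ x + f₂ x - f₃ x - f₄ x) / c ∂μ := by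
  have h₁₂ : Integrable (fun x => f₁ x + f₂ x) μ := h₁.add h₂
  have h₁₂₃ : Integrable (fun x => f₁ x + f₂ x - f₃ x) μ := h₁₂.sub h₃
  rw [integral_div, integral_sub h₁₂₃ h₄, integral_sub h₁₂ h₃, integral_add h₁ h₂]

theorem tendsto_integral_sin_mul_sin_complex {h : ℝ × ℝ → ℂ} (hh : Integrable h) :
    Tendsto (fun R : ℝ × ℝ => ∫ p : ℝ × ℝ,
      ((Real.sin (R.1 * p.1) * Real.sin (R.2 * p.2) : ℝ) : ℂ) * h p) (atTop ×ˢ atTop) (𝓝 0) := by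
  have a1 : Tendsto (fun R : ℝ × ℝ => |R.1|) (atTop ×ˢ atTop) atTop :=
    tendsto_abs_atTop_atTop.comp tendsto_fst
  have a2 : Tendsto (fun R : ℝ × ℝ => |-R.1|) (atTop ×ˢ atTop) atTop := by simpa using a1
  have l1 := tendsto_integral_cexp_plane (y := fun R : ℝ × ℝ => R.2) a2 h
  have l2 := tendsto_integral_cexp_plane (y := fun R : ℝ × ℝ => -R.2) a1 h
  have l3 := tendsto_integral_cexp_plane (y := fun R : ℝ × ℝ => -R.2) a2 h
  have l4 := tendsto_integral_cexp_plane (y := fun R : ℝ × ℝ => R.2) a1 h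
  have := (((l1.add l2).sub l3).sub l4).div_const 4
  simp only [add_zero, sub_zero, zero_div] at this
  refine this.congr fun R => ?_
  have c : ∀ x y : ℝ, Integrable (fun p : ℝ × ℝ =>
      Complex.exp (((x * p.1 + y * p.2 : ℝ) : ℂ) * Complex.I) * h p) := fun x y =>
    integrable_cexp_mul hh (by fun_prop)
  rw [integral_add_sub_sub_div (c _ _) (c _ _) (c _ _) (c _ _)]
  refine integral_congr_ae (Eventually.of_forall fun p => ?_)
  simp only [sin_mul_sin_eq]
  push_cast
  ring_nf

variable {E : Type*} [NormedAddCommGroup E] [NormedSpace ℝ E] [FiniteDimensional ℝ E]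

/-- Finite dimension allows a check in coordinates, which reduces vector-valued Riemann–Lebesgue
statements to scalar ones. -/
theorem tendsto_zero_of_forall_dual {α : Type*} {l : Filter α} {u : α → E}
    (h : ∀ φ : E →L[ℝ] ℝ, Tendsto (fun a => φ (u a)) l (𝓝 0)) : Tendsto u l (𝓝 0) := by
  let e := ContinuousLinearEquiv.ofFinrankEq (𝕜 := ℝ) (E := E)
    (F := Fin (Module.finrank ℝ E) → ℝ) (by simp)
  have h1 : Tendsto (fun a => e (u a)) l (𝓝 0) := by
    rw [tendsto_pi_nhds]
    intro i
    exact h ((ContinuousLinearMap.proj i).comp (e : E →L[ℝ] (Fin (Module.finrank ℝ E) → ℝ)))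
  have h2 := (e.symm.continuous.tendsto 0).comp h1
  simpa [Function.comp_def] using h2

/-- The Riemann–Lebesgue lemma in the plane, for products of sines. -/
theorem tendsto_integral_sin_mul_sin {H : ℝ × ℝ → E} (hH : Integrable H) :
    Tendsto (fun R : ℝ × ℝ => ∫ p : ℝ × ℝ,
      (Real.sin (R.1 * p.1) * Real.sin (R.2 * p.2)) • H p) (atTop ×ˢ atTop) (𝓝 0) := by
  have := FiniteDimensional.complete ℝ E
  refine tendsto_zero_of_forall_dual fun φ => ?_
  have h1 := tendsto_integral_sin_mul_sin_complex (h := fun p => (φ (H p) : ℂ))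
    (φ.integrable_comp hH).ofReal
  rw [← Complex.ofReal_zero] at h1
  refine (Complex.continuous_re.tendsto _ |>.comp h1).congr fun R => ?_
  have hi : Integrable (fun p : ℝ × ℝ =>
      (Real.sin (R.1 * p.1) * Real.sin (R.2 * p.2)) • H p) := by
    refine hH.bdd_smul 1 (by fun_prop) ?_
    filter_upwards with p
    rw [norm_mul]
    exact mul_le_one₀ (Real.abs_sin_le_one _) (abs_nonneg _) (Real.abs_sin_le_one _)
  rw [← φ.integral_comp_comm hi]
  simp only [← Complex.ofReal_mul, map_smul, smul_eq_mul, Function.comp_apply]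
  rw [integral_complex_ofReal, Complex.ofReal_re]

/-- The Riemann–Lebesgue lemma on the line, for sines. -/
theorem tendsto_integral_sin {H : ℝ → E} (hH : Integrable H) :
    Tendsto (fun N : ℝ => ∫ t : ℝ, Real.sin (N * t) • H t) atTop (𝓝 0) := by
  have := FiniteDimensional.complete ℝ E
  refine tendsto_zero_of_forall_dual fun φ => ?_
  have hx : Tendsto (fun N : ℝ => -N / (2 * Real.pi)) atTop (cocompact ℝ) := by
    have : Tendsto (fun N : ℝ => -N / (2 * Real.pi)) atTop atBot :=
      tendsto_neg_atTop_atBot.atBot_div_const (by positivity)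
    exact this.mono_right (by rw [cocompact_eq_atBot_atTop]; exact le_sup_left)
  have h1 := (Real.tendsto_integral_exp_smul_cocompact (fun t => (φ (H t) : ℂ))).comp hx
  -- The sine is recovered as the imaginary part of the exponential.
  rw [← Complex.zero_im]
  refine (Complex.continuous_im.tendsto _ |>.comp h1).congr fun N => ?_
  have hi : Integrable (fun t : ℝ => Real.sin (N * t) • H t) := by
    refine hH.bdd_smul 1 (by fun_prop) ?_
    filter_upwards with p
    exact Real.abs_sin_le_one _
  rw [← φ.integral_comp_comm hi]
  have hint : Integrable fun t : ℝ => Complex.exp (((N * t : ℝ) : ℂ) * Complex.I) *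
      (φ (H t) : ℂ) :=
    integrable_cexp_mul (φ.integrable_comp hH).ofReal (by fun_prop)
  have e : ∀ t : ℝ, Real.fourierChar (-(t * (-N / (2 * Real.pi)))) • (φ (H t) : ℂ) =
      Complex.exp (((N * t : ℝ) : ℂ) * Complex.I) * (φ (H t) : ℂ) := fun t => by
    simp only [Circle.smul_def, Real.fourierChar_apply, smul_eq_mul]
    congr 2
    have : (Real.pi : ℂ) ≠ 0 := by exact_mod_cast Real.pi_ne_zero
    push_cast
    field_simp
  simp only [Function.comp_apply, e]
  have := integral_im hint
  simp only [RCLike.im_to_complex] at this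
  rw [← this]
  refine integral_congr_ae (Eventually.of_forall fun t => ?_)
  simp only [Complex.mul_im, Complex.exp_ofReal_mul_I_im, Complex.ofReal_re, Complex.ofReal_im,
    mul_zero, zero_add, map_smul, smul_eq_mul]

end RiemannLebesgue

/-! ### The double Dirichlet integral away from the origin -/

section Away

variable {E : Type*} [NormedAddCommGroup E] [NormedSpace ℝ E] [FiniteDimensional ℝ E]

theorem tendsto_setIntegral_sin_mul_sin {K : ℝ × ℝ → E} {Q : Set (ℝ × ℝ)} (hQ : MeasurableSet Q)
    (hK : IntegrableOn K Q) :
    Tendsto (fun R : ℝ × ℝ => ∫ p in Q, (Real.sin (R.1 * p.1) * Real.sin (R.2 * p.2)) • K p)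
      (atTop ×ˢ atTop) (𝓝 0) := by
  refine (tendsto_integral_sin_mul_sin (hK.integrable_indicator hQ)).congr fun R => ?_
  rw [← integral_indicator hQ]
  refine integral_congr_ae (Eventually.of_forall fun p => ?_)
  by_cases hp : p ∈ Q <;> simp [hp]

theorem tendsto_setIntegral_sin {K : ℝ → E} {Q : Set ℝ} (hQ : MeasurableSet Q)
    (hK : IntegrableOn K Q) :
    Tendsto (fun N : ℝ => ∫ t in Q, Real.sin (N * t) • K t) atTop (𝓝 0) := by
  refine (tendsto_integral_sin (hK.integrable_indicator hQ)).congr fun R => ?_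
  rw [← integral_indicator hQ]
  refine integral_congr_ae (Eventually.of_forall fun p => ?_)
  by_cases hp : p ∈ Q <;> simp [hp]

theorem norm_inv_le_of_lt {ε t : ℝ} (hε : 0 < ε) (ht : ε < t) : ‖t⁻¹‖ ≤ ε⁻¹ := by
  rw [norm_inv, Real.norm_eq_abs, abs_of_pos (hε.trans ht)]
  exact inv_anti₀ hε ht.le

/-- The contribution of the far corner. -/
theorem tendsto_setIntegral_dirichletKer_far {H : ℝ × ℝ → E} {ε₁ ε₂ : ℝ} (hε₁ : 0 < ε₁)
    (hε₂ : 0 < ε₂) (hH : IntegrableOn H (Set.Ioi ε₁ ×ˢ Set.Ioi ε₂)) :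
    Tendsto (fun R : ℝ × ℝ => ∫ p in Set.Ioi ε₁ ×ˢ Set.Ioi ε₂,
      (dirichletKer R.1 p.1 * dirichletKer R.2 p.2) • H p) (atTop ×ˢ atTop) (𝓝 0) := by
  have hm : MeasurableSet (Set.Ioi ε₁ ×ˢ Set.Ioi ε₂) := measurableSet_Ioi.prod measurableSet_Ioi
  have hK : IntegrableOn (fun p : ℝ × ℝ => (p.1⁻¹ * p.2⁻¹) • H p)
      (Set.Ioi ε₁ ×ˢ Set.Ioi ε₂) := by
    refine Integrable.bdd_smul hH (ε₁⁻¹ * ε₂⁻¹) (by fun_prop) ?_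
    filter_upwards [ae_restrict_mem hm] with p hp
    rw [norm_mul]
    exact mul_le_mul (norm_inv_le_of_lt hε₁ hp.1) (norm_inv_le_of_lt hε₂ hp.2) (norm_nonneg _)
      (inv_nonneg.2 hε₁.le)
  refine (tendsto_setIntegral_sin_mul_sin hm hK).congr fun R => ?_
  refine setIntegral_congr_fun hm fun p hp => ?_
  rw [dirichletKer_of_ne_zero _ (hε₁.trans hp.1).ne', dirichletKer_of_ne_zero _
    (hε₂.trans hp.2).ne', smul_smul]
  congr 1
  ring

/-- The contribution of a strip. -/
theorem tendsto_setIntegral_dirichletKer_strip {G : ℝ → ℝ → E} {c : ℝ → E} {ε₁ ε₂ : ℝ}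
    (hε₁ : 0 < ε₁) (hε₂ : 0 < ε₂) (hc : Integrable c)
    (hG : IntegrableOn (fun p : ℝ × ℝ => p.1⁻¹ • (G p.1 p.2 - c p.2))
      (Set.Ioc 0 ε₁ ×ˢ Set.Ioi ε₂)) :
    Tendsto (fun R : ℝ × ℝ => ∫ p in Set.Ioc 0 ε₁ ×ˢ Set.Ioi ε₂,
      (dirichletKer R.1 p.1 * dirichletKer R.2 p.2) • G p.1 p.2) (atTop ×ˢ atTop) (𝓝 0) := by
  have := FiniteDimensional.complete ℝ E
  have hm : MeasurableSet (Set.Ioc 0 ε₁ ×ˢ Set.Ioi ε₂) := measurableSet_Ioc.prod measurableSet_Ioi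
  -- The integrand is split as `(G - c) + c`. For the difference, LC supplies the division by `s`,
  -- and `1/t` is bounded on the strip.
  have hK : IntegrableOn (fun p : ℝ × ℝ => p.2⁻¹ • p.1⁻¹ • (G p.1 p.2 - c p.2))
      (Set.Ioc 0 ε₁ ×ˢ Set.Ioi ε₂) := by
    refine Integrable.bdd_smul hG ε₂⁻¹ (by fun_prop) ?_
    filter_upwards [ae_restrict_mem hm] with p hp
    exact norm_inv_le_of_lt hε₂ hp.2
  have hc' : IntegrableOn (fun t : ℝ => t⁻¹ • c t) (Set.Ioi ε₂) := by
    refine Integrable.bdd_smul hc.integrableOn ε₂⁻¹ (by fun_prop) ?_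
    filter_upwards [ae_restrict_mem measurableSet_Ioi] with t ht
    exact norm_inv_le_of_lt hε₂ ht
  have l1 := tendsto_setIntegral_sin_mul_sin hm hK
  -- The part with `c` factors: the integral in `s` tends to `π/2`, the one in `t` to `0`.
  have l2 : Tendsto (fun R : ℝ × ℝ => (∫ s in (0 : ℝ)..ε₁, dirichletKer R.1 s) •
      ∫ t in Set.Ioi ε₂, Real.sin (R.2 * t) • t⁻¹ • c t) (atTop ×ˢ atTop)
      (𝓝 ((Real.pi / 2) • (0 : E))) :=
    ((tendsto_integral_dirichletKer hε₁).comp tendsto_fst).smul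
      ((tendsto_setIntegral_sin measurableSet_Ioi hc').comp tendsto_snd)
  have l3 := l1.add l2
  rw [smul_zero, add_zero] at l3
  refine l3.congr fun R => ?_
  have i1 : IntegrableOn (fun p : ℝ × ℝ => (Real.sin (R.1 * p.1) * Real.sin (R.2 * p.2)) •
      p.2⁻¹ • p.1⁻¹ • (G p.1 p.2 - c p.2)) (Set.Ioc 0 ε₁ ×ˢ Set.Ioi ε₂) := by
    refine Integrable.bdd_smul hK 1 (by fun_prop) ?_
    filter_upwards with p
    rw [norm_mul]
    exact mul_le_one₀ (Real.abs_sin_le_one _) (abs_nonneg _) (Real.abs_sin_le_one _)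
  have i2 : IntegrableOn (fun t : ℝ => Real.sin (R.2 * t) • t⁻¹ • c t) (Set.Ioi ε₂) := by
    refine Integrable.bdd_smul hc' 1 (by fun_prop) ?_
    filter_upwards with p
    exact Real.abs_sin_le_one _
  have i3 : IntegrableOn (dirichletKer R.1) (Set.Ioc 0 ε₁) :=
    ((continuous_dirichletKer R.1).integrableOn_Icc (a := 0) (b := ε₁)).mono_set
      Set.Ioc_subset_Icc_self
  have i4 : IntegrableOn (fun p : ℝ × ℝ => dirichletKer R.1 p.1 •
      (Real.sin (R.2 * p.2) • p.2⁻¹ • c p.2)) (Set.Ioc 0 ε₁ ×ˢ Set.Ioi ε₂) := by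
    rw [IntegrableOn, Measure.volume_eq_prod, ← Measure.prod_restrict]
    exact Integrable.smul_prod i3 i2
  have e : (∫ s in (0 : ℝ)..ε₁, dirichletKer R.1 s) •
      ∫ t in Set.Ioi ε₂, Real.sin (R.2 * t) • t⁻¹ • c t =
      ∫ p in Set.Ioc 0 ε₁ ×ˢ Set.Ioi ε₂, dirichletKer R.1 p.1 •
        (Real.sin (R.2 * p.2) • p.2⁻¹ • c p.2) := by
    rw [Measure.volume_eq_prod, ← Measure.prod_restrict,
      integral_prod_smul (dirichletKer R.1) fun t => Real.sin (R.2 * t) • t⁻¹ • c t,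
      intervalIntegral.integral_of_le hε₁.le]
  rw [e, ← integral_add i1 i4]
  refine setIntegral_congr_fun hm fun p hp => ?_
  rw [dirichletKer_of_ne_zero _ hp.1.1.ne', dirichletKer_of_ne_zero _ (hε₂.trans hp.2).ne']
  module

theorem tendsto_setIntegral_dirichletKer_strip' {G : ℝ → ℝ → E} {c : ℝ → E} {ε₁ ε₂ : ℝ}
    (hε₁ : 0 < ε₁) (hε₂ : 0 < ε₂) (hc : Integrable c)
    (hG : IntegrableOn (fun p : ℝ × ℝ => p.2⁻¹ • (G p.1 p.2 - c p.1))
      (Set.Ioi ε₁ ×ˢ Set.Ioc 0 ε₂)) :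
    Tendsto (fun R : ℝ × ℝ => ∫ p in Set.Ioi ε₁ ×ˢ Set.Ioc 0 ε₂,
      (dirichletKer R.1 p.1 * dirichletKer R.2 p.2) • G p.1 p.2) (atTop ×ˢ atTop) (𝓝 0) := by
  have hG' : IntegrableOn (fun p : ℝ × ℝ => p.1⁻¹ • (G p.2 p.1 - c p.2))
      (Set.Ioc 0 ε₂ ×ˢ Set.Ioi ε₁) := by
    rw [IntegrableOn, Measure.volume_eq_prod, ← Measure.prod_restrict] at hG ⊢
    exact hG.swap
  have hs : Tendsto (fun R : ℝ × ℝ => (R.2, R.1)) (atTop ×ˢ atTop) (atTop ×ˢ atTop) :=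
    tendsto_snd.prodMk tendsto_fst
  have h := (tendsto_setIntegral_dirichletKer_strip (G := fun x y => G y x) hε₂ hε₁ hc hG').comp hs
  refine h.congr fun R => ?_
  simp only [Function.comp_apply, Measure.volume_eq_prod]
  rw [← setIntegral_prod_swap]
  simp only [Prod.fst_swap, Prod.snd_swap, mul_comm]

end Away

/-! ### Symmetrization -/

section Symmetrization

theorem integrable_comp_neg_snd {E : Type*} [NormedAddCommGroup E]
    {μ : Measure ℝ} [SFinite μ] {H : ℝ × ℝ → E}
    (hH : Integrable H (μ.prod volume)) :
    Integrable (fun p : ℝ × ℝ => H (p.1, -p.2)) (μ.prod volume) :=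
  ((MeasurePreserving.id μ).prod
    (Measure.measurePreserving_neg (volume : Measure ℝ))).integrable_comp_of_integrable hH

variable {E : Type*} [NormedAddCommGroup E] [NormedSpace ℝ E]

theorem integral_eq_integral_Ioi_add {h : ℝ → E} (hh : Integrable h) :
    ∫ t, h t = ∫ t in Set.Ioi (0 : ℝ), (h t + h (-t)) := by
  have h1 : ∫ t in Set.Ioi (0 : ℝ), h (-t) = ∫ t in Set.Iic (0 : ℝ), h t := by
    simp
  rw [integral_add hh.integrableOn hh.comp_neg.integrableOn, h1, add_comm,
    intervalIntegral.integral_Iic_add_Ioi hh.integrableOn hh.integrableOn]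

/-- The measure in the first variable is left general so that the folding can be repeated, after a
swap, once the other variable is already restricted to the half-line. -/
theorem integral_prod_eq_integral_Ioi_add {μ : Measure ℝ} [SFinite μ] {H : ℝ × ℝ → E}
    (hH : Integrable H (μ.prod volume)) :
    Integrable (fun p : ℝ × ℝ => H p + H (p.1, -p.2)) (μ.prod (volume.restrict (Set.Ioi 0))) ∧
    ∫ p, H p ∂(μ.prod volume) =
      ∫ p, (H p + H (p.1, -p.2)) ∂(μ.prod (volume.restrict (Set.Ioi 0))) := by
  have hle : μ.prod (volume.restrict (Set.Ioi (0 : ℝ))) ≤ μ.prod volume :=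
    Measure.prod_mono le_rfl Measure.restrict_le_self
  have hi : Integrable (fun p : ℝ × ℝ => H p + H (p.1, -p.2))
      (μ.prod (volume.restrict (Set.Ioi 0))) :=
    (hH.add (integrable_comp_neg_snd hH)).mono_measure hle
  refine ⟨hi, ?_⟩
  rw [integral_prod _ hH, integral_prod _ hi]
  refine integral_congr_ae ?_
  filter_upwards [hH.prod_right_ae] with s hs
  exact integral_eq_integral_Ioi_add hs

/-- An integral over the plane as an integral over a quadrant. -/
theorem integral_eq_integral_quadrant {H : ℝ × ℝ → E} (hH : Integrable H) :
    ∫ p, H p = ∫ p in Set.Ioi (0 : ℝ) ×ˢ Set.Ioi (0 : ℝ),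
      (H (p.1, p.2) + H (p.1, -p.2) + (H (-p.1, p.2) + H (-p.1, -p.2))) := by
  rw [Measure.volume_eq_prod] at hH ⊢
  obtain ⟨i1, e1⟩ := integral_prod_eq_integral_Ioi_add hH
  obtain ⟨i2, e2⟩ := integral_prod_eq_integral_Ioi_add i1.swap
  rw [e1, ← integral_prod_swap]
  simp only [Function.comp_def] at e2
  rw [e2, ← Measure.prod_restrict, ← integral_prod_swap]
  rfl

end Symmetrization

/-! ### The Dirichlet integral of a function of class LC -/

section DirichletLC

theorem integrable_symmetrize {g : ℝ × ℝ → ℍ[ℝ]} (hg : Integrable g) (x₀ y₀ : ℝ) :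
    Integrable (fun p : ℝ × ℝ => symmetrize g x₀ y₀ p.1 p.2) := by
  have h1 : Integrable (fun p : ℝ × ℝ => g (x₀ + p.1, y₀ + p.2)) := hg.comp_add_left (x₀, y₀)
  have h2 : Integrable (fun p : ℝ × ℝ => g (x₀ + p.1, y₀ + -p.2)) := integrable_comp_neg_snd h1
  have h3 : Integrable (fun p : ℝ × ℝ => g (x₀ + -p.1, y₀ + -p.2)) := h1.comp_neg
  have h4 : Integrable (fun p : ℝ × ℝ => g (x₀ + -p.1, y₀ + - -p.2)) := h2.comp_neg
  simp only [neg_neg, ← sub_eq_add_neg] at h2 h3 h4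
  exact ((h3.add h1).add h4).add h2

/-- Translate to the origin and fold onto a quadrant; evenness of the kernel gathers the four
reflected values of `g` into the symmetrization. -/
theorem integral_dirichletKer_smul_eq {g : ℝ × ℝ → ℍ[ℝ]} (hg : Integrable g) (x₀ y₀ M N : ℝ) :
    ∫ p : ℝ × ℝ, (dirichletKer M (p.1 - x₀) * dirichletKer N (p.2 - y₀)) • g p =
      ∫ p in Set.Ioi (0 : ℝ) ×ˢ Set.Ioi (0 : ℝ),
        (dirichletKer M p.1 * dirichletKer N p.2) • symmetrize g x₀ y₀ p.1 p.2 := by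
  have h1 : Integrable (fun p : ℝ × ℝ => g (x₀ + p.1, y₀ + p.2)) := hg.comp_add_left (x₀, y₀)
  rw [← integral_add_left_eq_self _ ((x₀, y₀) : ℝ × ℝ)]
  simp only [Prod.fst_add, Prod.snd_add, add_sub_cancel_left]
  have h2 := integral_eq_integral_quadrant (integrable_dirichletKer_smul h1 M N)
  simp only [dirichletKer_neg, ← smul_add] at h2
  refine h2.trans ?_
  refine integral_congr_ae (Eventually.of_forall fun p => ?_)
  simp only [symmetrize, sub_eq_add_neg]
  congr 1
  abel

theorem quadrant_split {H : ℝ × ℝ → ℍ[ℝ]} (hH : Integrable H) {ε₁ ε₂ : ℝ} (hε₁ : 0 < ε₁)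
    (hε₂ : 0 < ε₂) :
    ∫ p in Set.Ioi (0 : ℝ) ×ˢ Set.Ioi (0 : ℝ), H p =
      (∫ p in Set.Ioc 0 ε₁ ×ˢ Set.Ioc 0 ε₂, H p) + (∫ p in Set.Ioc 0 ε₁ ×ˢ Set.Ioi ε₂, H p) +
      ((∫ p in Set.Ioi ε₁ ×ˢ Set.Ioc 0 ε₂, H p) + ∫ p in Set.Ioi ε₁ ×ˢ Set.Ioi ε₂, H p) := by
  have key : ∀ S : Set ℝ, MeasurableSet S → ∫ p in S ×ˢ Set.Ioi (0 : ℝ), H p =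
      (∫ p in S ×ˢ Set.Ioc 0 ε₂, H p) + ∫ p in S ×ˢ Set.Ioi ε₂, H p := fun S hS => by
    rw [← Set.Ioc_union_Ioi_eq_Ioi hε₂.le, Set.prod_union]
    exact setIntegral_union (Set.disjoint_prod.2 (Or.inr (Set.Ioc_disjoint_Ioi le_rfl)))
      (hS.prod measurableSet_Ioi) hH.integrableOn hH.integrableOn
  rw [← key _ measurableSet_Ioc, ← key _ measurableSet_Ioi]
  conv_lhs => rw [← Set.Ioc_union_Ioi_eq_Ioi hε₁.le, Set.union_prod]
  rw [Set.Ioc_union_Ioi_eq_Ioi hε₁.le]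
  exact setIntegral_union (Set.disjoint_prod.2 (Or.inl (Set.Ioc_disjoint_Ioi le_rfl)))
    (measurableSet_Ioi.prod measurableSet_Ioi) hH.integrableOn hH.integrableOn

/-- The pointwise convergence of the double Dirichlet integral. -/
theorem IsLC.tendsto_integral_dirichletKer {g : ℝ × ℝ → ℍ[ℝ]} (hg : Integrable g)
    {x₀ y₀ ε₁ ε₂ V : ℝ} (hε₁ : 0 < ε₁) (hε₂ : 0 < ε₂) (hLC : IsLC g x₀ y₀ ε₁ ε₂)
    (hHK : HKBounded (symmetrize g x₀ y₀) (Set.Ioc 0 ε₁) (Set.Ioc 0 ε₂) V) {L : ℍ[ℝ]}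
    (hL : Tendsto (fun p : ℝ × ℝ => symmetrize g x₀ y₀ p.1 p.2) (𝓝[>] 0 ×ˢ 𝓝[>] 0) (𝓝 L)) :
    Tendsto (fun R : ℝ × ℝ => ∫ p : ℝ × ℝ,
      (dirichletKer R.1 (p.1 - x₀) * dirichletKer R.2 (p.2 - y₀)) • g p) (atTop ×ˢ atTop)
      (𝓝 ((Real.pi / 2 * (Real.pi / 2)) • L)) := by
  obtain ⟨⟨a, ha, ha'⟩, b, hb, hb'⟩ := hLC
  have hi := integrable_symmetrize hg x₀ y₀
  have l1 := hHK.tendsto_setIntegral hε₁ hε₂ hi.integrableOn hL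
  have l2 := tendsto_setIntegral_dirichletKer_strip hε₁ hε₂ ha
    (ha'.mono_set (Set.prod_mono subset_rfl Set.Ioi_subset_Ici_self))
  have l3 := tendsto_setIntegral_dirichletKer_strip' hε₁ hε₂ hb
    (hb'.mono_set (Set.prod_mono Set.Ioi_subset_Ici_self subset_rfl))
  have l4 := tendsto_setIntegral_dirichletKer_far hε₁ hε₂
    (hi.integrableOn (s := Set.Ioi ε₁ ×ˢ Set.Ioi ε₂))
  have l := (l1.add l2).add (l3.add l4)
  simp only [add_zero] at l
  refine l.congr fun R => ?_
  rw [integral_dirichletKer_smul_eq hg, quadrant_split (integrable_dirichletKer_smul hi _ _)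
    hε₁ hε₂]

end DirichletLC

/-! ### From subdivisions to monotone sequences -/

section Subdivision

theorem IsSubdivision.exists_append {a c d : ℝ} {k : ℕ} {s : ℕ → ℝ} (hs : IsSubdivision a c k s)
    (hcd : c ≤ d) :
    ∃ (k' : ℕ) (s' : ℕ → ℝ), IsSubdivision a d k' s' ∧ ∀ φ : ℝ → ℝ → ℝ, (∀ x, φ x x = 0) →
      ∑ i ∈ Finset.range k, φ (s i) (s (i + 1)) + φ c d ≤
        ∑ i ∈ Finset.range k', φ (s' i) (s' (i + 1)) := by
  rcases hcd.eq_or_lt with rfl | hlt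
  · exact ⟨k, s, hs, fun φ hφ => by rw [hφ, add_zero]⟩
  obtain ⟨h0, hk, hlt'⟩ := hs
  refine ⟨k + 1, fun i => if i ≤ k then s i else d, ⟨by simp [h0], by simp, fun i hi => ?_⟩,
    fun φ _ => ?_⟩
  · rcases (Nat.lt_succ_iff.1 hi).eq_or_lt with rfl | hik
    · simpa [hk] using hlt
    · dsimp only
      rw [if_pos hik.le, if_pos (by omega)]
      exact hlt' i hik
  · rw [Finset.sum_range_succ]
    refine le_of_eq (congr_arg₂ _ (Finset.sum_congr rfl fun i hi => ?_) (by simp [hk]))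
    have : i < k := Finset.mem_range.1 hi
    dsimp only
    rw [if_pos (by omega), if_pos (by omega)]

/-- A monotone sequence may repeat points and need not reach the ends. Repetitions contribute zero
and can be dropped, and the cells added at the ends contribute nonnegatively. -/
theorem exists_isSubdivision {a b : ℝ} {u : ℕ → ℝ} (hu : Monotone u)
    (hus : ∀ i, u i ∈ Set.Icc a b) (m : ℕ) :
    ∃ (k : ℕ) (s : ℕ → ℝ), IsSubdivision a b k s ∧ ∀ φ : ℝ → ℝ → ℝ, (∀ x, φ x x = 0) →
      (∀ x y, 0 ≤ φ x y) → ∑ i ∈ Finset.range m, φ (u i) (u (i + 1)) ≤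
        ∑ i ∈ Finset.range k, φ (s i) (s (i + 1)) := by
  have key : ∃ (k : ℕ) (s : ℕ → ℝ), IsSubdivision a (u m) k s ∧ ∀ φ : ℝ → ℝ → ℝ,
      (∀ x, φ x x = 0) → (∀ x y, 0 ≤ φ x y) → ∑ i ∈ Finset.range m, φ (u i) (u (i + 1)) ≤
        ∑ i ∈ Finset.range k, φ (s i) (s (i + 1)) := by
    induction m with
    | zero =>
      have h0 : IsSubdivision a a 0 fun _ => a := ⟨rfl, rfl, by simp⟩
      obtain ⟨k, s, hs, hsum⟩ := h0.exists_append (hus 0).1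
      exact ⟨k, s, hs, fun φ h1 h2 => by simpa using Finset.sum_nonneg fun i _ => h2 _ _⟩
    | succ m ih =>
      obtain ⟨k, s, hs, hsum⟩ := ih
      obtain ⟨k', s', hs', hsum'⟩ := hs.exists_append (hu (Nat.le_succ m))
      refine ⟨k', s', hs', fun φ h1 h2 => ?_⟩
      rw [Finset.sum_range_succ]
      have e1 := hsum φ h1 h2
      have e2 := hsum' φ h1
      linarith
  obtain ⟨k, s, hs, hsum⟩ := key
  obtain ⟨k', s', hs', hsum'⟩ := hs.exists_append (hus m).2
  refine ⟨k', s', hs', fun φ h1 h2 => ?_⟩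
  have e1 := hsum φ h1 h2
  have e2 := hsum' φ h1
  have e3 := h2 (u m) b
  linarith

/-- The grid is completed to a subdivision in one variable at a time; the sum over the other
variable is itself a nonnegative function of a step that vanishes on trivial steps. -/
theorem IsBVF.exists_hkBounded {f : ℝ × ℝ → ℝ} {a₁ b₁ a₂ b₂ : ℝ} (hf : IsBVF f a₁ b₁ a₂ b₂) :
    ∃ V, HKBounded (fun s t => f (s, t)) (Set.Icc a₁ b₁) (Set.Icc a₂ b₂) V := by
  obtain ⟨⟨C, hC⟩, ⟨s₀, hs₀, h₂⟩, t₀, ht₀, h₁⟩ := hf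
  obtain ⟨V₁, -, hV₁⟩ := exists_variationLE h₁
  obtain ⟨V₂, -, hV₂⟩ := exists_variationLE h₂
  refine CellVariationLE.exists_hkBounded (W := C) (fun m n u v hu hv hus hvt => ?_) hs₀ ht₀ hV₁ hV₂
  obtain ⟨k, s, hs, hsum⟩ := exists_isSubdivision hu hus m
  obtain ⟨l, t, ht, htsum⟩ := exists_isSubdivision hv hvt n
  refine le_trans ?_ (hC k l s t hs ht)
  refine (Finset.sum_le_sum fun i _ => htsum (fun x y => ‖cellDelta (fun s t => f (s, t)) (u i)
    (u (i + 1)) x y‖) (fun x => by simp [cellDelta]) fun _ _ => norm_nonneg _).trans ?_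
  exact hsum (fun x y => ∑ j ∈ Finset.range l, ‖cellDelta (fun s t => f (s, t)) x y (t j)
    (t (j + 1))‖) (fun x => by simp [cellDelta]) fun _ _ => Finset.sum_nonneg fun _ _ =>
      norm_nonneg _

end Subdivision

/-! ### Quaternion-valued functions of bounded variation -/

section Quaternion

theorem HKBounded.smul_const {F : ℝ → ℝ → ℝ} {S T : Set ℝ} {V : ℝ} (hF : HKBounded F S T V)
    (e : ℍ[ℝ]) : ∃ V', HKBounded (fun s t => F s t • e) S T V' := by
  have hconst : VariationLE (fun _ : ℝ => e) S ‖e‖ := fun n u _ _ => by simp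
  have := HKBounded.bilinear ((ContinuousLinearMap.lsmul ℝ ℝ : ℝ →L[ℝ] ℍ[ℝ] →L[ℝ] ℍ[ℝ]).flip)
    (norm_nonneg e) (abs_nonneg V) hconst (fun _ _ => le_rfl)
    (hF.mono subset_rfl subset_rfl (le_abs_self V))
  exact ⟨_, by simpa using this⟩

/-- The quaternion unit `k`. -/
def qk : ℍ[ℝ] := ⟨0, 0, 0, 1⟩

@[simp] theorem qi_re : qi.re = 0 := rfl
@[simp] theorem qi_imI : qi.imI = 1 := rfl
@[simp] theorem qi_imJ : qi.imJ = 0 := rfl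
@[simp] theorem qi_imK : qi.imK = 0 := rfl
@[simp] theorem qj_re : qj.re = 0 := rfl
@[simp] theorem qj_imI : qj.imI = 0 := rfl
@[simp] theorem qj_imJ : qj.imJ = 1 := rfl
@[simp] theorem qj_imK : qj.imK = 0 := rfl
@[simp] theorem qk_re : qk.re = 0 := rfl
@[simp] theorem qk_imI : qk.imI = 0 := rfl
@[simp] theorem qk_imJ : qk.imJ = 0 := rfl
@[simp] theorem qk_imK : qk.imK = 1 := rfl

theorem quaternion_eq_sum (q : ℍ[ℝ]) : q = q.re • (1 : ℍ[ℝ]) + q.imI • qi + q.imJ • qj +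
    q.imK • qk := by
  ext <;> simp

theorem IsQBVF.exists_hkBounded {f : ℝ × ℝ → ℍ[ℝ]} {a₁ b₁ a₂ b₂ : ℝ}
    (hf : IsQBVF f a₁ b₁ a₂ b₂) :
    ∃ V, HKBounded (fun s t => f (s, t)) (Set.Icc a₁ b₁) (Set.Icc a₂ b₂) V := by
  obtain ⟨h1, h2, h3, h4⟩ := hf
  obtain ⟨V₁, k1⟩ := h1.exists_hkBounded.choose_spec.smul_const 1
  obtain ⟨V₂, k2⟩ := h2.exists_hkBounded.choose_spec.smul_const qi
  obtain ⟨V₃, k3⟩ := h3.exists_hkBounded.choose_spec.smul_const qj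
  obtain ⟨V₄, k4⟩ := h4.exists_hkBounded.choose_spec.smul_const qk
  have h := ((k1.add k2).add k3).add k4
  simp only [← quaternion_eq_sum] at h
  exact ⟨_, h⟩

theorem exists_variationLE_of_contDiff {φ : ℝ → ℍ[ℝ]} (hφ : ContDiff ℝ 1 φ) {a b : ℝ}
    (hab : a ≤ b) :
    ∃ C, 0 ≤ C ∧ VariationLE φ (Set.Icc a b) C ∧ ∀ s ∈ Set.Icc a b, ‖φ s‖ ≤ C := by
  obtain ⟨K, hK⟩ := hφ.locallyLipschitz.locallyLipschitzOn.exists_lipschitzOnWith_of_compact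
    (isCompact_Icc (a := a) (b := b))
  have hbv := hK.locallyBoundedVariationOn a b ⟨le_rfl, hab⟩ ⟨hab, le_rfl⟩
  rw [Set.inter_self] at hbv
  obtain ⟨C, hC, hV⟩ := exists_variationLE hbv
  obtain ⟨D, hD⟩ := isCompact_Icc.exists_bound_of_continuousOn (hφ.continuous.continuousOn
    (s := Set.Icc a b))
  exact ⟨max C D, hC.trans (le_max_left _ _), hV.mono subset_rfl (le_max_left _ _),
    fun s hs => (hD s hs).trans (le_max_right _ _)⟩

/-- A `C¹` factor is Lipschitz on a compact interval, hence of bounded variation. The left factor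
uses the bilinear estimate in the first variable, the right one the flipped product after exchanging
variables. -/
theorem HKBounded.mul_mul {f : ℝ → ℝ → ℍ[ℝ]} {a₁ b₁ a₂ b₂ V : ℝ} (h₁ : a₁ ≤ b₁) (h₂ : a₂ ≤ b₂)
    (hf : HKBounded f (Set.Icc a₁ b₁) (Set.Icc a₂ b₂) V) {φ χ : ℝ → ℍ[ℝ]} (hφ : ContDiff ℝ 1 φ)
    (hχ : ContDiff ℝ 1 χ) :
    ∃ V', HKBounded (fun s t => φ s * f s t * χ t) (Set.Icc a₁ b₁) (Set.Icc a₂ b₂) V' := by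
  obtain ⟨C, hC, hφ1, hφ2⟩ := exists_variationLE_of_contDiff hφ h₁
  obtain ⟨D, hD, hχ1, hχ2⟩ := exists_variationLE_of_contDiff hχ h₂
  have h3 := HKBounded.bilinear (ContinuousLinearMap.mul ℝ ℍ[ℝ]) hC (abs_nonneg V) hφ1 hφ2
    (hf.mono subset_rfl subset_rfl (le_abs_self V))
  have h4 := HKBounded.bilinear (ContinuousLinearMap.mul ℝ ℍ[ℝ]).flip hD (abs_nonneg _) hχ1 hχ2
    (h3.mono subset_rfl subset_rfl (le_abs_self _)).swap
  exact ⟨_, by simpa using h4.swap⟩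

theorem HKBounded.comp_affine {F : ℝ → ℝ → ℍ[ℝ]} {x₀ ε V σ : ℝ} {T : Set ℝ}
    (hσ : σ = 1 ∨ σ = -1) (hF : HKBounded F (Set.Icc (x₀ - ε) (x₀ + ε)) T V) :
    HKBounded (fun s t => F (x₀ + σ * s) t) (Set.Ioc 0 ε) T V := by
  rcases hσ with rfl | rfl
  · refine hF.comp_monotone (σ := fun s => x₀ + 1 * s) (fun x y h => ?_) fun s hs => ?_
    · dsimp only; linarith
    · constructor <;> linarith [hs.1, hs.2]
  · refine hF.comp_antitone (σ := fun s => x₀ + -1 * s) (fun x y h => ?_) fun s hs => ?_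
    · dsimp only; linarith
    · constructor <;> linarith [hs.1, hs.2]

theorem HKBounded.comp_affine₂ {F : ℝ → ℝ → ℍ[ℝ]} {x₀ y₀ ε₁ ε₂ V σ τ : ℝ}
    (hσ : σ = 1 ∨ σ = -1) (hτ : τ = 1 ∨ τ = -1)
    (hF : HKBounded F (Set.Icc (x₀ - ε₁) (x₀ + ε₁)) (Set.Icc (y₀ - ε₂) (y₀ + ε₂)) V) :
    HKBounded (fun s t => F (x₀ + σ * s) (y₀ + τ * t)) (Set.Ioc 0 ε₁) (Set.Ioc 0 ε₂) V :=
  ((hF.comp_affine hσ).swap.comp_affine hτ).swap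

theorem HKBounded.symmetrize {g : ℝ × ℝ → ℍ[ℝ]} {x₀ y₀ ε₁ ε₂ V : ℝ}
    (hg : HKBounded (fun s t => g (s, t)) (Set.Icc (x₀ - ε₁) (x₀ + ε₁))
      (Set.Icc (y₀ - ε₂) (y₀ + ε₂)) V) :
    ∃ V', HKBounded (symmetrize g x₀ y₀) (Set.Ioc 0 ε₁) (Set.Ioc 0 ε₂) V' := by
  have h := (((hg.comp_affine₂ (Or.inr rfl) (Or.inr rfl)).add
    (hg.comp_affine₂ (Or.inl rfl) (Or.inl rfl))).add
    (hg.comp_affine₂ (Or.inr rfl) (Or.inl rfl))).add (hg.comp_affine₂ (Or.inl rfl) (Or.inr rfl))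
  simp only [one_mul, neg_mul, ← sub_eq_add_neg] at h
  exact ⟨_, h⟩

theorem tendsto_add_mul_nhdsGT (x₀ σ : ℝ) :
    Tendsto (fun s => x₀ + σ * s) (𝓝[>] 0) (𝓝 x₀) := by
  have : Tendsto (fun s => x₀ + σ * s) (𝓝 0) (𝓝 (x₀ + σ * 0)) :=
    (by fun_prop : Continuous fun s => x₀ + σ * s).tendsto 0
  rw [mul_zero, add_zero] at this
  exact this.mono_left nhdsWithin_le_nhds

theorem tendsto_sub_nhdsGT (x₀ : ℝ) : Tendsto (fun x => x - x₀) (𝓝[>] x₀) (𝓝[>] 0) := by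
  refine tendsto_nhdsWithin_iff.2 ⟨?_, ?_⟩
  · have : Tendsto (fun x => x - x₀) (𝓝 x₀) (𝓝 (x₀ - x₀)) := tendsto_id.sub_const x₀
    rw [sub_self] at this
    exact this.mono_left nhdsWithin_le_nhds
  · filter_upwards [self_mem_nhdsWithin] with x hx
    exact sub_pos.2 (Set.mem_Ioi.1 hx)

theorem tendsto_sub_nhdsLT (x₀ : ℝ) : Tendsto (fun x => x₀ - x) (𝓝[<] x₀) (𝓝[>] 0) := by
  refine tendsto_nhdsWithin_iff.2 ⟨?_, ?_⟩
  · have : Tendsto (fun x => x₀ - x) (𝓝 x₀) (𝓝 (x₀ - x₀)) := tendsto_id.const_sub x₀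
    rw [sub_self] at this
    exact this.mono_left nhdsWithin_le_nhds
  · filter_upwards [self_mem_nhdsWithin] with x hx
    exact sub_pos.2 (Set.mem_Iio.1 hx)

end Quaternion

/-! ### The kernels of the transform -/

section Kernel

/-- `inPlane` as a continuous linear map. -/
noncomputable def inPlaneL (μ : ℍ[ℝ]) : ℂ →L[ℝ] ℍ[ℝ] :=
  Complex.reCLM.smulRight (1 : ℍ[ℝ]) + Complex.imCLM.smulRight μ

theorem coe_eq_smul_one (x : ℝ) : (x : ℍ[ℝ]) = x • (1 : ℍ[ℝ]) := by
  ext <;> simp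

theorem inPlaneL_apply (μ : ℍ[ℝ]) (z : ℂ) : inPlaneL μ z = inPlane μ z := by
  simp [inPlaneL, inPlane, coe_eq_smul_one]

theorem inPlane_mul {μ : ℍ[ℝ]} (hμ : μ * μ = -1) (z w : ℂ) :
    inPlane μ (z * w) = inPlane μ z * inPlane μ w := by
  simp only [inPlane, coe_eq_smul_one, mul_add, add_mul, smul_mul_smul_comm, one_mul, mul_one, hμ,
    Complex.mul_re, Complex.mul_im]
  module

theorem inPlane_one (μ : ℍ[ℝ]) : inPlane μ 1 = 1 := by simp [inPlane]

theorem inPlane_ofReal_mul (μ : ℍ[ℝ]) (r : ℝ) (z : ℂ) :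
    inPlane μ ((r : ℂ) * z) = r • inPlane μ z := by
  simp only [← inPlaneL_apply, ← map_smul, Complex.real_smul]

theorem qi_mul_qi : qi * qi = -1 := by ext <;> simp

theorem qj_mul_qj : qj * qj = -1 := by ext <;> simp

/-- The complex number whose copy in a plane is the kernel. -/
noncomputable def kernelC (A : Matrix.SpecialLinearGroup (Fin 2) ℝ) (s u : ℝ) : ℂ :=
  1 / (Complex.I * ((2 * Real.pi * A 0 1 : ℝ) : ℂ)) ^ (1 / 2 : ℂ) *
    Complex.exp (Complex.I *
      ((A 0 0 / (2 * A 0 1) * s ^ 2 - 1 / A 0 1 * (u * s) + A 1 1 / (2 * A 0 1) * u ^ 2 : ℝ) : ℂ))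

theorem kernel_eq (μ : ℍ[ℝ]) (A : Matrix.SpecialLinearGroup (Fin 2) ℝ) (s u : ℝ) :
    kernel μ A s u = inPlane μ (kernelC A s u) := rfl

/-- The chirp `exp (I a s² / 2b)`. -/
noncomputable def chirpC (A : Matrix.SpecialLinearGroup (Fin 2) ℝ) (s : ℝ) : ℂ :=
  Complex.exp (Complex.I * ((A 0 0 / (2 * A 0 1) * s ^ 2 : ℝ) : ℂ))

/-- The two bases are conjugate and off the branch cut, so the principal roots are conjugate and
their product is `|z| = r`. It is needed because `A⁻¹` has upper right entry `-b`. -/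
theorem sqrt_I_mul_mul_sqrt_I_mul_neg {r : ℝ} (hr : 0 < r) :
    (Complex.I * (r : ℂ)) ^ (1 / 2 : ℂ) * (Complex.I * ((-r : ℝ) : ℂ)) ^ (1 / 2 : ℂ) = r := by
  set z : ℂ := Complex.I * (r : ℂ) with hz
  have hconj : Complex.I * ((-r : ℝ) : ℂ) = (starRingEnd ℂ) z := by simp [hz]
  have harg : z.arg ≠ Real.pi := by
    rw [Ne, Complex.arg_eq_pi_iff]
    simp [hz]
  have h2 : (starRingEnd ℂ) (1 / 2 : ℂ) = 1 / 2 := by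
    have : (1 / 2 : ℂ) = ((1 / 2 : ℝ) : ℂ) := by push_cast; rfl
    rw [this, Complex.conj_ofReal]
  have hz0 : z ≠ 0 := by simp [hz, hr.ne']
  rw [hconj, Complex.conj_cpow _ _ harg, h2, Complex.mul_conj, Complex.normSq_eq_norm_sq, sq,
    ← norm_mul, ← Complex.cpow_add _ _ hz0]
  norm_num [hz, abs_of_pos hr]

/-- The terms in `u²` cancel, which leaves a pure exponential in `u` and chirps independent of `u`.
-/
theorem kernelC_inv_mul (A : Matrix.SpecialLinearGroup (Fin 2) ℝ) (hb : 0 < A 0 1)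
    (x₀ s u : ℝ) : kernelC A⁻¹ u x₀ * kernelC A s u =
      ((1 / (2 * Real.pi * A 0 1) : ℝ) : ℂ) * (Complex.exp ((u * ((x₀ - s) / A 0 1) : ℝ) *
        Complex.I) * (chirpC A s * (chirpC A x₀)⁻¹)) := by
  have e00 : A⁻¹ 0 0 = A 1 1 := by simp [Matrix.SpecialLinearGroup.SL2_inv_expl]
  have e01 : A⁻¹ 0 1 = -A 0 1 := by simp [Matrix.SpecialLinearGroup.SL2_inv_expl]
  have e11 : A⁻¹ 1 1 = A 0 0 := by simp [Matrix.SpecialLinearGroup.SL2_inv_expl]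
  have hr : 0 < 2 * Real.pi * A 0 1 := by positivity
  have hs := sqrt_I_mul_mul_sqrt_I_mul_neg hr
  rw [kernelC, kernelC, e00, e01, e11, mul_neg, mul_mul_mul_comm, one_div_mul_one_div,
    mul_comm ((Complex.I * _) ^ (1 / 2 : ℂ)), hs, ← Complex.exp_add, chirpC, chirpC,
    ← Complex.exp_neg, ← Complex.exp_add, ← Complex.exp_add]
  congr 1
  · push_cast; rfl
  · congr 1
    have : (A 0 1 : ℂ) ≠ 0 := by exact_mod_cast hb.ne'
    push_cast
    field_simp
    ring

theorem integral_cexp_mul_I (M y : ℝ) :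
    ∫ u in (-M)..M, Complex.exp ((u * y : ℝ) * Complex.I) =
      ((2 * M * Real.sinc (M * y) : ℝ) : ℂ) := by
  rcases eq_or_ne y 0 with rfl | hy
  · simp; ring
  · have h := intervalIntegral.integral_comp_mul_right (a := -M) (b := M)
      (fun t : ℝ => Complex.exp ((t : ℂ) * Complex.I)) hy
    rw [h, neg_mul, integral_exp_mul_I_eq_sinc, Complex.real_smul]
    have : (y : ℂ) ≠ 0 := by exact_mod_cast hy
    push_cast
    field_simp

theorem integral_kernelC_inv_mul (A : Matrix.SpecialLinearGroup (Fin 2) ℝ) (hb : 0 < A 0 1)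
    (x₀ s M : ℝ) : ∫ u in (-M)..M, kernelC A⁻¹ u x₀ * kernelC A s u =
      ((1 / Real.pi * dirichletKer (M / A 0 1) (s - x₀) : ℝ) : ℂ) *
        (chirpC A s * (chirpC A x₀)⁻¹) := by
  simp only [kernelC_inv_mul A hb]
  rw [intervalIntegral.integral_const_mul, intervalIntegral.integral_mul_const,
    integral_cexp_mul_I, dirichletKer]
  have e : M * ((x₀ - s) / A 0 1) = -(M / A 0 1 * (s - x₀)) := by ring
  rw [e, Real.sinc_neg, ← mul_assoc, ← Complex.ofReal_mul]
  congr 2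
  have := Real.pi_ne_zero
  field_simp

theorem continuous_kernelC_inv_mul (A : Matrix.SpecialLinearGroup (Fin 2) ℝ) (hb : 0 < A 0 1)
    (x₀ : ℝ) : Continuous fun p : ℝ × ℝ => kernelC A⁻¹ p.1 x₀ * kernelC A p.2 p.1 := by
  simp only [kernelC_inv_mul A hb, chirpC]
  fun_prop

theorem norm_chirpC (A : Matrix.SpecialLinearGroup (Fin 2) ℝ) (s : ℝ) : ‖chirpC A s‖ = 1 := by
  rw [chirpC, mul_comm, Complex.norm_exp_ofReal_mul_I]

theorem norm_kernelC_inv_mul (A : Matrix.SpecialLinearGroup (Fin 2) ℝ) (hb : 0 < A 0 1)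
    (x₀ s u : ℝ) : ‖kernelC A⁻¹ u x₀ * kernelC A s u‖ = 1 / (2 * Real.pi * A 0 1) := by
  rw [kernelC_inv_mul A hb, norm_mul, norm_mul, norm_mul, norm_inv, norm_chirpC, norm_chirpC,
    Complex.norm_exp_ofReal_mul_I, Complex.norm_real, Real.norm_eq_abs, abs_of_pos (by positivity)]
  norm_num

/-- The product of the kernels of the inverse and of the direct transform. -/
noncomputable def kernelProd (μ : ℍ[ℝ]) (A : Matrix.SpecialLinearGroup (Fin 2) ℝ) (x₀ u s : ℝ) :
    ℍ[ℝ] := inPlane μ (kernelC A⁻¹ u x₀ * kernelC A s u)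

theorem continuous_inPlane (μ : ℍ[ℝ]) : Continuous (inPlane μ) := by
  have : inPlane μ = inPlaneL μ := funext fun z => (inPlaneL_apply μ z).symm
  rw [this]
  exact (inPlaneL μ).continuous

theorem continuous_kernelProd (μ : ℍ[ℝ]) (A : Matrix.SpecialLinearGroup (Fin 2) ℝ)
    (hb : 0 < A 0 1) (x₀ : ℝ) : Continuous fun p : ℝ × ℝ => kernelProd μ A x₀ p.1 p.2 :=
  (continuous_inPlane μ).comp (continuous_kernelC_inv_mul A hb x₀)

theorem exists_norm_kernelProd_le (μ : ℍ[ℝ]) (A : Matrix.SpecialLinearGroup (Fin 2) ℝ)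
    (hb : 0 < A 0 1) (x₀ : ℝ) : ∃ C, ∀ u s, ‖kernelProd μ A x₀ u s‖ ≤ C := by
  refine ⟨‖inPlaneL μ‖ * (1 / (2 * Real.pi * A 0 1)), fun u s => ?_⟩
  rw [kernelProd, ← inPlaneL_apply, ← norm_kernelC_inv_mul A hb x₀ s u]
  exact (inPlaneL μ).le_opNorm _

theorem integral_kernelProd (μ : ℍ[ℝ]) (A : Matrix.SpecialLinearGroup (Fin 2) ℝ)
    (hb : 0 < A 0 1) (x₀ s M : ℝ) : ∫ u in (-M)..M, kernelProd μ A x₀ u s =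
      (1 / Real.pi * dirichletKer (M / A 0 1) (s - x₀)) •
        inPlane μ (chirpC A s * (chirpC A x₀)⁻¹) := by
  have hc : Continuous fun u => kernelC A⁻¹ u x₀ * kernelC A s u := by
    simp only [kernelC_inv_mul A hb, chirpC]
    fun_prop
  have h1 := (inPlaneL μ).intervalIntegral_comp_comm (hc.intervalIntegrable (μ := volume) (-M) M)
  have h2 := congrArg (inPlane μ) (integral_kernelC_inv_mul A hb x₀ s M)
  simp only [inPlaneL_apply] at h1
  exact h1.trans (h2.trans (inPlane_ofReal_mul μ _ _))

end Kernel

/-! ### The truncated inverse transform as a Dirichlet integral -/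

section Inversion

theorem integral_integral_mul_left {α : ℝ → ℝ × ℝ → ℍ[ℝ]} (hα : Continuous (Function.uncurry α))
    {C : ℝ} (hC : ∀ u p, ‖α u p‖ ≤ C) {h : ℝ × ℝ → ℍ[ℝ]} (hh : Integrable h) {M : ℝ}
    (hM : 0 ≤ M) :
    ∫ u in (-M)..M, ∫ p, α u p * h p = ∫ p, (∫ u in (-M)..M, α u p) * h p := by
  simp only [intervalIntegral.integral_of_le (neg_le_self hM)]
  rw [integral_integral_swap]
  · refine integral_congr_ae (Eventually.of_forall fun p => ?_)
    have hc : Continuous fun u => α u p :=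
      hα.comp (by fun_prop : Continuous fun u : ℝ => (u, p))
    exact integral_mul_const_of_integrable (hc.integrableOn_Icc.mono_set Set.Ioc_subset_Icc_self)
  · exact (hh.comp_snd (volume.restrict (Set.Ioc (-M) M))).bdd_mul (c := C)
      hα.aestronglyMeasurable (Eventually.of_forall fun p => hC p.1 p.2)

theorem integral_integral_mul_right {α : ℝ → ℝ × ℝ → ℍ[ℝ]} (hα : Continuous (Function.uncurry α))
    {C : ℝ} (hC : ∀ u p, ‖α u p‖ ≤ C) {h : ℝ × ℝ → ℍ[ℝ]} (hh : Integrable h) {M : ℝ}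
    (hM : 0 ≤ M) :
    ∫ u in (-M)..M, ∫ p, h p * α u p = ∫ p, h p * ∫ u in (-M)..M, α u p := by
  simp only [intervalIntegral.integral_of_le (neg_le_self hM)]
  rw [integral_integral_swap]
  · refine integral_congr_ae (Eventually.of_forall fun p => ?_)
    have hc : Continuous fun u => α u p :=
      hα.comp (by fun_prop : Continuous fun u : ℝ => (u, p))
    exact integral_const_mul_of_integrable (hc.integrableOn_Icc.mono_set Set.Ioc_subset_Icc_self)
  · exact (hh.comp_snd (volume.restrict (Set.Ioc (-M) M))).mul_bdd (c := C)
      hα.aestronglyMeasurable (Eventually.of_forall fun p => hC p.1 p.2)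

variable {A₁ A₂ : Matrix.SpecialLinearGroup (Fin 2) ℝ} {f : ℝ × ℝ → ℍ[ℝ]}

/-- The constant kernels enter the integral from their own sides. The two left factors multiply in
the plane of `i`, the two right ones in that of `j`, where they may be reordered. -/
theorem kernel_mul_transform_mul_kernel (x₀ y₀ u v : ℝ)
    (hf : Integrable fun p : ℝ × ℝ => kernel qi A₁ p.1 u * f p * kernel qj A₂ p.2 v) :
    kernel qi A₁⁻¹ u x₀ * transform A₁ A₂ f u v * kernel qj A₂⁻¹ v y₀ =
      ∫ p : ℝ × ℝ, kernelProd qi A₁ x₀ u p.1 * (f p * kernelProd qj A₂ y₀ v p.2) := by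
  rw [transform, ← integral_const_mul_of_integrable hf,
    ← integral_mul_const_of_integrable (hf.const_mul _)]
  refine integral_congr_ae (Eventually.of_forall fun p => ?_)
  simp only [kernelProd, kernel_eq]
  rw [inPlane_mul qi_mul_qi, mul_comm (kernelC A₂⁻¹ v y₀), inPlane_mul qj_mul_qj]
  simp only [mul_assoc]

theorem chirped_eq (p : ℝ × ℝ) : chirped A₁ A₂ f p =
    inPlane qi (chirpC A₁ p.1) * f p * inPlane qj (chirpC A₂ p.2) := rfl

theorem continuous_kernelC (A : Matrix.SpecialLinearGroup (Fin 2) ℝ) (u : ℝ) :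
    Continuous fun s => kernelC A s u := by
  unfold kernelC
  fun_prop

theorem norm_kernelC (A : Matrix.SpecialLinearGroup (Fin 2) ℝ) (s u : ℝ) :
    ‖kernelC A s u‖ = ‖1 / (Complex.I * ((2 * Real.pi * A 0 1 : ℝ) : ℂ)) ^ (1 / 2 : ℂ)‖ := by
  rw [kernelC, norm_mul, Complex.norm_exp_I_mul_ofReal, mul_one]

theorem integrable_inPlane_mul_mul (hf : Integrable f) {φ χ : ℝ → ℂ} (hφ : Continuous φ)
    (hχ : Continuous χ) {C D : ℝ} (hC : ∀ s, ‖φ s‖ ≤ C) (hD : ∀ t, ‖χ t‖ ≤ D) :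
    Integrable fun p : ℝ × ℝ => inPlane qi (φ p.1) * f p * inPlane qj (χ p.2) := by
  refine (hf.bdd_mul (c := ‖inPlaneL qi‖ * C) ?_ (Eventually.of_forall fun p => ?_)).mul_bdd
    (c := ‖inPlaneL qj‖ * D) ?_ (Eventually.of_forall fun p => ?_)
  · exact ((continuous_inPlane qi).comp (hφ.comp continuous_fst)).aestronglyMeasurable
  · rw [← inPlaneL_apply]
    exact (inPlaneL qi).le_opNorm_of_le (hC _)
  · exact ((continuous_inPlane qj).comp (hχ.comp continuous_snd)).aestronglyMeasurable
  · rw [← inPlaneL_apply]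
    exact (inPlaneL qj).le_opNorm_of_le (hD _)

theorem continuous_chirpC (A : Matrix.SpecialLinearGroup (Fin 2) ℝ) : Continuous (chirpC A) := by
  unfold chirpC
  fun_prop

theorem integrable_chirped (hf : Integrable f) : Integrable (chirped A₁ A₂ f) :=
  integrable_inPlane_mul_mul (φ := chirpC A₁) (χ := chirpC A₂) hf
    (continuous_chirpC A₁) (continuous_chirpC A₂)
    (fun s => (norm_chirpC A₁ s).le) fun t => (norm_chirpC A₂ t).le

end Inversion

/-! ### Exchange of the frequency integrals with the plane integral -/

section Fubini

variable {f : ℝ × ℝ → ℍ[ℝ]}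

/-- One frequency is exchanged at a time, over a finite interval with a bounded continuous factor;
no factor ever crosses `f`. -/
theorem integral_integral_integral_mul_mul {α β : ℝ → ℝ → ℍ[ℝ]}
    (hα : Continuous fun p : ℝ × ℝ => α p.1 p.2) (hβ : Continuous fun p : ℝ × ℝ => β p.1 p.2)
    {C D : ℝ} (hC : ∀ u s, ‖α u s‖ ≤ C) (hD : ∀ v t, ‖β v t‖ ≤ D) (hf : Integrable f) {M N : ℝ}
    (hM : 0 ≤ M) (hN : 0 ≤ N) :
    ∫ v in (-N)..N, ∫ u in (-M)..M, ∫ p : ℝ × ℝ, α u p.1 * (f p * β v p.2) =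
      ∫ p : ℝ × ℝ, (∫ u in (-M)..M, α u p.1) * f p * ∫ v in (-N)..N, β v p.2 := by
  have hα' : Continuous (Function.uncurry fun (u : ℝ) (p : ℝ × ℝ) => α u p.1) :=
    hα.comp (by fun_prop : Continuous fun q : ℝ × ℝ × ℝ => (q.1, q.2.1))
  have hβ' : Continuous (Function.uncurry fun (v : ℝ) (p : ℝ × ℝ) => β v p.2) :=
    hβ.comp (by fun_prop : Continuous fun q : ℝ × ℝ × ℝ => (q.1, q.2.2))
  have hfβ : ∀ v, Integrable fun p : ℝ × ℝ => f p * β v p.2 := fun v =>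
    hf.mul_bdd (c := D) (hβ'.comp (by fun_prop : Continuous fun p : ℝ × ℝ =>
      (v, p))).aestronglyMeasurable (Eventually.of_forall fun p => hD _ _)
  have hXf : Integrable fun p : ℝ × ℝ => (∫ u in (-M)..M, α u p.1) * f p := by
    refine hf.bdd_mul (c := C * |M - -M|) ?_ (Eventually.of_forall fun p =>
      intervalIntegral.norm_integral_le_of_norm_le_const fun u _ => hC _ _)
    refine (intervalIntegral.continuous_parametric_intervalIntegral_of_continuous' ?_ _
      _).aestronglyMeasurable
    exact hα'.comp continuous_swap
  have h1 : ∀ v, ∫ u in (-M)..M, ∫ p : ℝ × ℝ, α u p.1 * (f p * β v p.2) =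
      ∫ p : ℝ × ℝ, ((∫ u in (-M)..M, α u p.1) * f p) * β v p.2 := fun v => by
    simp only [mul_assoc]
    exact integral_integral_mul_left hα' (fun u p => hC u p.1) (hfβ v) hM
  simp only [h1]
  exact integral_integral_mul_right hβ' (fun v p => hD v p.2) hXf hN

end Fubini

section Inversion

variable {A₁ A₂ : Matrix.SpecialLinearGroup (Fin 2) ℝ} {f : ℝ × ℝ → ℍ[ℝ]}

/-- Real scalars are central, and commutativity of the plane of `i` lets `z'` move to the far left;
`w'` is already on the far right. -/
theorem smul_inPlane_mul_smul_inPlane (c r₁ r₂ : ℝ) (z z' w w' : ℂ) (q : ℍ[ℝ]) :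
    ((c * r₁) • inPlane qi (z * z')) * q * ((c * r₂) • inPlane qj (w * w')) =
      (c * c) • (inPlane qi z' * ((r₁ * r₂) • (inPlane qi z * q * inPlane qj w)) *
        inPlane qj w') := by
  rw [mul_comm z, inPlane_mul qi_mul_qi, inPlane_mul qj_mul_qj]
  simp only [smul_mul_assoc, mul_smul_comm, smul_smul, mul_assoc]
  congr 1
  ring

theorem integrable_dirichletKer_sub_smul {g : ℝ × ℝ → ℍ[ℝ]} (hg : Integrable g)
    (x₀ y₀ M N : ℝ) : Integrable fun p : ℝ × ℝ =>
      (dirichletKer M (p.1 - x₀) * dirichletKer N (p.2 - y₀)) • g p := by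
  have := (integrable_dirichletKer_smul (hg.comp_add_left (x₀, y₀)) M N).comp_sub_right (x₀, y₀)
  simpa using this

theorem truncatedInverse_eq (hb₁ : 0 < A₁ 0 1) (hb₂ : 0 < A₂ 0 1) (hf : Integrable f)
    (x₀ y₀ : ℝ) {M N : ℝ} (hM : 0 ≤ M) (hN : 0 ≤ N) :
    truncatedInverse A₁ A₂ (transform A₁ A₂ f) x₀ y₀ M N =
      (1 / Real.pi * (1 / Real.pi)) • (inPlane qi (chirpC A₁ x₀)⁻¹ *
        (∫ p : ℝ × ℝ, (dirichletKer (M / A₁ 0 1) (p.1 - x₀) *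
          dirichletKer (N / A₂ 0 1) (p.2 - y₀)) • chirped A₁ A₂ f p) *
        inPlane qj (chirpC A₂ y₀)⁻¹) := by
  obtain ⟨C, hC⟩ := exists_norm_kernelProd_le qi A₁ hb₁ x₀
  obtain ⟨D, hD⟩ := exists_norm_kernelProd_le qj A₂ hb₂ y₀
  have h1 := integral_integral_integral_mul_mul (continuous_kernelProd qi A₁ hb₁ x₀)
    (continuous_kernelProd qj A₂ hb₂ y₀) hC hD hf hM hN
  have h2 : ∀ u v, kernel qi A₁⁻¹ u x₀ * transform A₁ A₂ f u v * kernel qj A₂⁻¹ v y₀ =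
      ∫ p : ℝ × ℝ, kernelProd qi A₁ x₀ u p.1 * (f p * kernelProd qj A₂ y₀ v p.2) := fun u v =>
    kernel_mul_transform_mul_kernel x₀ y₀ u v (integrable_inPlane_mul_mul
      (φ := fun s => kernelC A₁ s u) (χ := fun t => kernelC A₂ t v) hf
      (continuous_kernelC A₁ u) (continuous_kernelC A₂ v) (fun s => (norm_kernelC A₁ s u).le)
      fun t => (norm_kernelC A₂ t v).le)
  have hg := integrable_dirichletKer_sub_smul (integrable_chirped (A₁ := A₁) (A₂ := A₂) hf)
    x₀ y₀ (M / A₁ 0 1) (N / A₂ 0 1)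
  rw [truncatedInverse]
  simp only [h2]
  rw [h1, ← integral_const_mul_of_integrable hg,
    ← integral_mul_const_of_integrable (hg.const_mul _), ← integral_smul]
  refine integral_congr_ae (Eventually.of_forall fun p => ?_)
  simp only [integral_kernelProd qi A₁ hb₁ x₀, integral_kernelProd qj A₂ hb₂ y₀, chirped_eq]
  exact smul_inPlane_mul_smul_inPlane _ _ _ _ _ _ _ _

end Inversion

/-! ### The inversion theorem -/

section Main

variable {A₁ A₂ : Matrix.SpecialLinearGroup (Fin 2) ℝ} {f : ℝ × ℝ → ℍ[ℝ]}

theorem contDiff_inPlane_chirpC (μ : ℍ[ℝ]) (A : Matrix.SpecialLinearGroup (Fin 2) ℝ) :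
    ContDiff ℝ 1 fun s => inPlane μ (chirpC A s) := by
  have h : ContDiff ℝ 1 (chirpC A) := by
    unfold chirpC
    refine ContDiff.cexp (contDiff_const.mul (Complex.ofRealCLM.contDiff.comp ?_))
    exact contDiff_const.mul (contDiff_id.pow 2)
  simpa only [Function.comp_def, inPlaneL_apply] using (inPlaneL μ).contDiff.comp h

theorem HKBounded.exists_tendsto_quadrant {x₀ y₀ ε₁ ε₂ V σ τ : ℝ} (hε₁ : 0 < ε₁) (hε₂ : 0 < ε₂)
    (hσ : σ = 1 ∨ σ = -1) (hτ : τ = 1 ∨ τ = -1)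
    (hf : HKBounded (fun s t => f (s, t)) (Set.Icc (x₀ - ε₁) (x₀ + ε₁))
      (Set.Icc (y₀ - ε₂) (y₀ + ε₂)) V) :
    ∃ L, Tendsto (fun p : ℝ × ℝ => f (x₀ + σ * p.1, y₀ + τ * p.2)) (𝓝[>] 0 ×ˢ 𝓝[>] 0) (𝓝 L) :=
  (hf.comp_affine₂ hσ hτ).exists_tendsto hε₁ hε₂

theorem tendsto_chirped_quadrant {x₀ y₀ σ τ : ℝ} {L : ℍ[ℝ]}
    (hf : Tendsto (fun p : ℝ × ℝ => f (x₀ + σ * p.1, y₀ + τ * p.2)) (𝓝[>] 0 ×ˢ 𝓝[>] 0) (𝓝 L)) :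
    Tendsto (fun p : ℝ × ℝ => chirped A₁ A₂ f (x₀ + σ * p.1, y₀ + τ * p.2)) (𝓝[>] 0 ×ˢ 𝓝[>] 0)
      (𝓝 (inPlane qi (chirpC A₁ x₀) * L * inPlane qj (chirpC A₂ y₀))) := by
  simp only [chirped_eq]
  refine (Tendsto.mul ?_ hf).mul ?_
  · exact ((contDiff_inPlane_chirpC qi A₁).continuous.tendsto x₀).comp
      ((tendsto_add_mul_nhdsGT x₀ σ).comp tendsto_fst)
  · exact ((contDiff_inPlane_chirpC qj A₂).continuous.tendsto y₀).comp
      ((tendsto_add_mul_nhdsGT y₀ τ).comp tendsto_snd)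

theorem inPlane_inv_mul_cancel {μ : ℍ[ℝ]} (hμ : μ * μ = -1)
    (A : Matrix.SpecialLinearGroup (Fin 2) ℝ) (s : ℝ) :
    inPlane μ (chirpC A s)⁻¹ * inPlane μ (chirpC A s) = 1 := by
  have : chirpC A s ≠ 0 := Complex.exp_ne_zero _
  rw [← inPlane_mul hμ, inv_mul_cancel₀ this, inPlane_one]

theorem inPlane_mul_inv_cancel {μ : ℍ[ℝ]} (hμ : μ * μ = -1)
    (A : Matrix.SpecialLinearGroup (Fin 2) ℝ) (s : ℝ) :
    inPlane μ (chirpC A s) * inPlane μ (chirpC A s)⁻¹ = 1 := by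
  have : chirpC A s ≠ 0 := Complex.exp_ne_zero _
  rw [← inPlane_mul hμ, mul_inv_cancel₀ this, inPlane_one]

/-- The constant is `(1/π)² (π/2)² = 1/4`, and the chirps cancel on each side. -/
theorem unchirp_limit (x₀ y₀ : ℝ) (q : ℍ[ℝ]) :
    (1 / Real.pi * (1 / Real.pi)) • (inPlane qi (chirpC A₁ x₀)⁻¹ *
      ((Real.pi / 2 * (Real.pi / 2)) •
        (inPlane qi (chirpC A₁ x₀) * q * inPlane qj (chirpC A₂ y₀))) *
      inPlane qj (chirpC A₂ y₀)⁻¹) = (1 / 4 : ℝ) • q := by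
  have h1 := inPlane_inv_mul_cancel qi_mul_qi A₁ x₀
  have h2 := inPlane_mul_inv_cancel qj_mul_qj A₂ y₀
  have h3 : inPlane qi (chirpC A₁ x₀)⁻¹ *
      (inPlane qi (chirpC A₁ x₀) * q * inPlane qj (chirpC A₂ y₀)) *
      inPlane qj (chirpC A₂ y₀)⁻¹ = q := by
    simp only [mul_assoc]
    rw [h2, mul_one, ← mul_assoc, h1, one_mul]
  rw [mul_smul_comm, smul_mul_assoc, h3, smul_smul]
  congr 1
  have := Real.pi_ne_zero
  field_simp
  norm_num

theorem tendsto_truncatedInverse (hb₁ : 0 < A₁ 0 1) (hb₂ : 0 < A₂ 0 1) (hf : Integrable f)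
    {x₀ y₀ : ℝ} {q : ℍ[ℝ]}
    (h : Tendsto (fun R : ℝ × ℝ => ∫ p : ℝ × ℝ, (dirichletKer R.1 (p.1 - x₀) *
      dirichletKer R.2 (p.2 - y₀)) • chirped A₁ A₂ f p) (atTop ×ˢ atTop)
      (𝓝 ((Real.pi / 2 * (Real.pi / 2)) •
        (inPlane qi (chirpC A₁ x₀) * q * inPlane qj (chirpC A₂ y₀))))) :
    Tendsto (fun R : ℝ × ℝ => truncatedInverse A₁ A₂ (transform A₁ A₂ f) x₀ y₀ R.1 R.2)
      (atTop ×ˢ atTop) (𝓝 ((1 / 4 : ℝ) • q)) := by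
  have hs : Tendsto (fun R : ℝ × ℝ => (R.1 / A₁ 0 1, R.2 / A₂ 0 1)) (atTop ×ˢ atTop)
      (atTop ×ˢ atTop) :=
    (tendsto_fst.atTop_div_const hb₁).prodMk (tendsto_snd.atTop_div_const hb₂)
  rw [← unchirp_limit (A₁ := A₁) (A₂ := A₂) x₀ y₀ q]
  refine Tendsto.congr' ?_ ((((h.comp hs).const_mul _).mul_const _).const_smul _)
  -- The Dirichlet form of the truncated inverse is available for nonnegative `M`, `N` only, which
  -- suffices at infinity.
  filter_upwards [(eventually_ge_atTop (0 : ℝ)).prod_mk (eventually_ge_atTop (0 : ℝ))] with R hR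
  exact (truncatedInverse_eq hb₁ hb₂ hf x₀ y₀ hR.1 hR.2).symm

end Main

end QLCT

theorem mainTheorem4 (A₁ A₂ : Matrix.SpecialLinearGroup (Fin 2) ℝ)
    (hb₁ : 0 < A₁ 0 1) (hb₂ : 0 < A₂ 0 1)
    (f : ℝ × ℝ → ℍ[ℝ]) (hf : Integrable f)
    (x₀ y₀ ε₁ ε₂ : ℝ) (hε₁ : 0 < ε₁) (hε₂ : 0 < ε₂)
    (hBV : QLCT.IsQBVF f (x₀ - ε₁) (x₀ + ε₁) (y₀ - ε₂) (y₀ + ε₂))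
    (hLC : QLCT.IsLC (QLCT.chirped A₁ A₂ f) x₀ y₀ ε₁ ε₂) :
    ∃ fpp fpm fmp fmm : ℍ[ℝ],
      Tendsto f (𝓝[>] x₀ ×ˢ 𝓝[>] y₀) (𝓝 fpp) ∧
      Tendsto f (𝓝[>] x₀ ×ˢ 𝓝[<] y₀) (𝓝 fpm) ∧
      Tendsto f (𝓝[<] x₀ ×ˢ 𝓝[>] y₀) (𝓝 fmp) ∧
      Tendsto f (𝓝[<] x₀ ×ˢ 𝓝[<] y₀) (𝓝 fmm) ∧
      Tendsto (fun R : ℝ × ℝ =>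
          QLCT.truncatedInverse A₁ A₂ (QLCT.transform A₁ A₂ f) x₀ y₀ R.1 R.2)
        (atTop ×ˢ atTop) (𝓝 ((1 / 4 : ℝ) • (fpp + fpm + fmp + fmm))) := by
  obtain ⟨V, hV⟩ := hBV.exists_hkBounded
  have hone : (1 : ℝ) = 1 ∨ (1 : ℝ) = -1 := Or.inl rfl
  have hneg : (-1 : ℝ) = 1 ∨ (-1 : ℝ) = -1 := Or.inr rfl
  obtain ⟨fpp, hpp⟩ := hV.exists_tendsto_quadrant hε₁ hε₂ hone hone
  obtain ⟨fpm, hpm⟩ := hV.exists_tendsto_quadrant hε₁ hε₂ hone hneg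
  obtain ⟨fmp, hmp⟩ := hV.exists_tendsto_quadrant hε₁ hε₂ hneg hone
  obtain ⟨fmm, hmm⟩ := hV.exists_tendsto_quadrant hε₁ hε₂ hneg hneg
  have cpp := QLCT.tendsto_chirped_quadrant (A₁ := A₁) (A₂ := A₂) hpp
  have cpm := QLCT.tendsto_chirped_quadrant (A₁ := A₁) (A₂ := A₂) hpm
  have cmp := QLCT.tendsto_chirped_quadrant (A₁ := A₁) (A₂ := A₂) hmp
  have cmm := QLCT.tendsto_chirped_quadrant (A₁ := A₁) (A₂ := A₂) hmm
  simp only [one_mul, neg_mul, ← sub_eq_add_neg] at hpp hpm hmp hmm cpp cpm cmp cmm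
  refine ⟨fpp, fpm, fmp, fmm, ?_, ?_, ?_, ?_, ?_⟩
  · simpa [Function.comp_def] using
      hpp.comp ((QLCT.tendsto_sub_nhdsGT x₀).prodMap (QLCT.tendsto_sub_nhdsGT y₀))
  · simpa [Function.comp_def] using
      hpm.comp ((QLCT.tendsto_sub_nhdsGT x₀).prodMap (QLCT.tendsto_sub_nhdsLT y₀))
  · simpa [Function.comp_def] using
      hmp.comp ((QLCT.tendsto_sub_nhdsLT x₀).prodMap (QLCT.tendsto_sub_nhdsGT y₀))
  · simpa [Function.comp_def] using
      hmm.comp ((QLCT.tendsto_sub_nhdsLT x₀).prodMap (QLCT.tendsto_sub_nhdsLT y₀))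
  -- Bounded variation is assumed for `f` but needed for the chirped function; the chirps are smooth
  -- factors of one variable each.
  · obtain ⟨W, hW⟩ := hV.mul_mul (by linarith) (by linarith)
      (QLCT.contDiff_inPlane_chirpC QLCT.qi A₁) (QLCT.contDiff_inPlane_chirpC QLCT.qj A₂)
    obtain ⟨W', hW'⟩ := QLCT.HKBounded.symmetrize (g := QLCT.chirped A₁ A₂ f) hW
    refine QLCT.tendsto_truncatedInverse hb₁ hb₂ hf
      (QLCT.IsLC.tendsto_integral_dirichletKer (QLCT.integrable_chirped hf) hε₁ hε₂ hLC hW' ?_)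
    -- The limits are added in the order of the terms of `symmetrize`.
    convert! ((cmm.add cpp).add cmp).add cpm using 2
    simp only [mul_add, add_mul]
    abel
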